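/- **Theorem 1.4.** Let $X\subset\mathbb R^6$ be the cone of pseudo-tetrahedra, that is, non-negative labellings $d=(d_{ij})_{1\le i<j\le4}$ of the edges of $K_4$ that satisfy the triangle inequality around each $3$-cycle. Let $f(d)$ be the Cayley–Menger determinant $$f(d)=\det\begin{pmatrix}0&1&1&1&1\\1&0&d_{12}^2&d_{13}^2&d_{14}^2\\1&d_{12}^2&0&d_{23}^2&d_{24}^2\\1&d_{13}^2&d_{23}^2&0&d_{34}^2\\1&d_{14}^2&d_{24}^2&d_{34}^2&0\end{pmatrix},$$ and for a set $\beta$ of edges of $K_4$ let $D_\beta f$ be the directional derivative of $f$ in the direction of the indicator vector of $\beta$. A *decoration* $D$ consists of an embedded $3$-path in $K_4$, a white endpoint of the path, and a black vertex of the path which is neither the white endpoint nor adjacent to it along the path; there are $48$ decorations. The *chamber* $X_D\subset X$ is the set of $d\in X$ such that: among the three axis sums (sums of the labels of two opposite edges), the one of the opposite pair contained in the path is largest and the one of the opposite pair disjoint from the path is smallest; among the four vertex sums (sums of the labels of the three edges at a vertex), the one at the black vertex is smallest; and the vertex sum at the white vertex is not greater than the one at its neighbour along the path (all inequalities weak).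 Below, $\beta\subset D$ means that every edge of $\beta$ is an edge of the path of $D$. A nonempty edge set $\beta\subset K_4$ is *friendly* if $K_4-\beta$ is not a nonempty set of edges all incident to the same vertex. (In particular $\beta=K_4$ is friendly.) For each friendly $\beta$ there are a nonempty union $X_\beta$ of chambers and constants $A_\beta<B_\beta$ with $B_\beta>0$ such that, with $g=D_\beta f$, $$g\sum_{i<j}d_{ij}-Cf\ \ge 0\ \text{ on } X_\beta\quad\Longleftrightarrow\quad C\in[A_\beta,B_\beta],$$ and every chamber $X_D$ not among those that make up $X_\beta$ contains a point where $f>0$ and $g<0$. Explicitly, this holds with the following choices. * $\beta=K_4$: all $48$ chambers, so that $X_\beta=X$; $(A_\beta,B_\beta)=(16,36)$. * $\beta$ a single edge: the $12$ chambers $X_D$ such that $\beta\not\subset D$ and the black vertex of $D$ is an endpoint of $\beta$; $(A_\beta,B_\beta)=(0,2)$. * $\beta$ a pair of incident edges: the $4$ chambers $X_D$ such that $\beta$ is disjoint from the set of the outer two edges of $D$ and the black vertex is incident to both edges of $\beta$; $(A_\beta,B_\beta)=(-8,12)$. * $\beta$ a pair of opposite edges: the $32$ chambers $X_D$ such that $\beta\not\subset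 D$; $A_\beta\le0$ and $B_\beta\ge4$. * $\beta$ the three edges at a vertex $v$: the $12$ chambers $X_D$ such that the black vertex of $D$ is $v$; $(A_\beta,B_\beta)=(8,18)$. * $\beta$ a $3$-path: the $8$ chambers $X_D$ such that the black vertex of $D$ is an interior vertex of $\beta$ and the outer two edges of $D$ do not belong to $\beta$; $A_\beta\le-6$ and $B_\beta\ge16$. * $\beta$ a $4$-cycle: the $16$ chambers $X_D$ such that the outer two edges of $D$ do not belong to $\beta$; $(A_\beta,B_\beta)=(0,24)$. -/

import Mathlib

open Finset

/-- The six edges of the complete graph `K₄` on the vertex set `Fin 4`. -/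
abbrev K4Edge : Type := {e : Sym2 (Fin 4) // ¬ e.IsDiag}

/-- The edge of `K₄` that joins the vertices `p i` and `p j`, for a labelling `p` of the vertices. -/
def edge (p : Equiv.Perm (Fin 4)) (i j : Fin 4) (h : i ≠ j := by decide) : K4Edge :=
  ⟨s(p i, p j), by simpa using h⟩

/-- `d_{ij}`: the label of the edge `ij` in the labelling `d` of the edges of `K₄`, and `d_{ii} = 0`. -/
def len (d : K4Edge → ℝ) (i j : Fin 4) : ℝ :=
  if h : i = j then 0 else d ⟨s(i, j), by simpa using h⟩

/-- The polyhedral cone `X` of pseudo-tetrahedra: non-negative labellings of the edges of `K₄` that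
satisfy the triangle inequalities around each 3-cycle. -/
def pseudoTetrahedra : Set (K4Edge → ℝ) :=
  {d | (∀ e, 0 ≤ d e) ∧
    ∀ i j k : Fin 4, i ≠ j → j ≠ k → i ≠ k → len d i k ≤ len d i j + len d j k}

/-- The Cayley-Menger determinant `f`. -/
noncomputable def cayleyMenger (d : K4Edge → ℝ) : ℝ :=
  Matrix.det
    !![0, 1, 1, 1, 1;
       1, 0, len d 0 1 ^ 2, len d 0 2 ^ 2, len d 0 3 ^ 2;
       1, len d 1 0 ^ 2, 0, len d 1 2 ^ 2, len d 1 3 ^ 2;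
       1, len d 2 0 ^ 2, len d 2 1 ^ 2, 0, len d 2 3 ^ 2;
       1, len d 3 0 ^ 2, len d 3 1 ^ 2, len d 3 2 ^ 2, 0]

/-- The directional derivative `D_β f` of the Cayley-Menger determinant along the edge subset `β`,
that is, in the direction of the indicator vector of `β`. -/
noncomputable def cayleyMengerDeriv (β : Finset K4Edge) (d : K4Edge → ℝ) : ℝ :=
  lineDeriv ℝ cayleyMenger d (fun e => if e ∈ β then 1 else 0)

/-- The sum of the three labels at the vertex `v`. -/
def vertexSum (d : K4Edge → ℝ) (v : Fin 4) : ℝ := ∑ j, len d v j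

/-- The sum of the labels of the opposite edges `ij` and `kl`. -/
def axisSum (d : K4Edge → ℝ) (i j k l : Fin 4) : ℝ := len d i j + len d k l

/-- A decoration of `K₄`: an embedded 3-path, given by the list `path 0, path 1, path 2, path 3` of
its vertices, which starts at the white endpoint, together with a black vertex of the path that is
neither the white endpoint nor its neighbour along the path. -/
abbrev Decoration : Type :=
  {D : Equiv.Perm (Fin 4) × Fin 4 // D.2 = D.1 2 ∨ D.2 = D.1 3}

namespace Decoration

/-- The vertices of the 3-path in order, starting at the white endpoint. -/
def path (D : Decoration) : Equiv.Perm (Fin 4) := D.1.1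

/-- The white endpoint of the path. -/
def white (D : Decoration) : Fin 4 := D.path 0

/-- The vertex next to the white endpoint along the path. -/
def whiteNeighbor (D : Decoration) : Fin 4 := D.path 1

/-- The black vertex. -/
def black (D : Decoration) : Fin 4 := D.1.2

/-- The three edges of the path. -/
def edges (D : Decoration) : Finset K4Edge := {edge D.path 0 1, edge D.path 1 2, edge D.path 2 3}

/-- The outer two edges of the path; they form the only opposite pair contained in the path. -/
def outerEdges (D : Decoration) : Finset K4Edge := {edge D.path 0 1, edge D.path 2 3}

/-- The chamber `X_D`. The opposite pair contained in the path has the largest axis sum, the opposite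
pair disjoint from the path has the smallest axis sum, the black vertex has the smallest vertex sum,
and the vertex sum at the white vertex is at most the vertex sum at its neighbour on the path. -/
def chamber (D : Decoration) : Set (K4Edge → ℝ) :=
  {d | d ∈ pseudoTetrahedra ∧
    axisSum d (D.path 0) (D.path 3) (D.path 1) (D.path 2)
      ≤ axisSum d (D.path 0) (D.path 1) (D.path 2) (D.path 3) ∧
    axisSum d (D.path 0) (D.path 2) (D.path 1) (D.path 3)
      ≤ axisSum d (D.path 0) (D.path 3) (D.path 1) (D.path 2) ∧
    (∀ v, vertexSum d D.black ≤ vertexSum d v) ∧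
    vertexSum d D.white ≤ vertexSum d D.whiteNeighbor}

end Decoration

/-- The union of the chambers `X_D` over the decorations `D` in `S`. -/
def chamberUnion (S : Finset Decoration) : Set (K4Edge → ℝ) := ⋃ D ∈ S, D.chamber

/-- There are 48 decorations. -/
theorem card_decoration : Fintype.card Decoration = 48 := by decide +kernel

/-- A nonempty edge subset `β` is friendly if its complement is not a nonempty set of edges that are
all incident to the same vertex. -/
def Friendly (β : Finset K4Edge) : Prop :=
  β.Nonempty ∧ ¬ (βᶜ.Nonempty ∧ ∃ v : Fin 4, ∀ e ∈ βᶜ, v ∈ e.1)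

/-- Let `X_β` be the union of the chambers of the decorations in `S`, and let `g = D_β f`. Then
`A < B`, `B > 0`, the function `g ∑ d_{ij} - C f` is non-negative on `X_β` if and only if
`C ∈ [A, B]`, and every chamber outside `X_β` contains a point where `f > 0` and `g < 0`. -/
def HasSharpConstants (β : Finset K4Edge) (S : Finset Decoration) (A B : ℝ) : Prop :=
  A < B ∧ 0 < B ∧
  (∀ C : ℝ,
    (∀ d ∈ chamberUnion S, 0 ≤ cayleyMengerDeriv β d * (∑ e, d e) - C * cayleyMenger d) ↔
      C ∈ Set.Icc A B) ∧
  ∀ D : Decoration, D ∉ S → ∃ d ∈ D.chamber, 0 < cayleyMenger d ∧ cayleyMengerDeriv β d < 0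

/-!
Up to a relabelling of the vertices, a chamber is one of two cones, according to whether the black
vertex is the other endpoint of the path or the neighbour of that endpoint. The differences of the
axis sums, the differences of the vertex sums and one triangle inequality are linear coordinates on
`ℝ⁶`, the other triangle inequalities are consequences of this one, and so the cone is simplicial:
`mem_chamber_iff` identifies it with the image of the non-negative orthant under `coneMap`. The
labelling by the path turns the edge set `β` into a subset of `Fin 6`, so that only finitely many
pairs of a cone and an edge set (`relPos`) remain.

On such a cone, `g ∑ d - C f` is a homogeneous polynomial of degree six in the six cone parameters.
Since it is affine in `C`, it suffices to prove that it is non-negative for the two extreme constants.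
With few exceptions its coefficients are then non-negative; in the exceptional cases this holds after
subtraction of a square times a polynomial with non-negative coefficients. These facts are checked by
kernel computation with polynomials that have natural coefficients, the terms with negative signs
being moved to the other side (`certifies`). The last cone parameter is set to `1` in this
computation, and homogeneity and continuity give the inequality on the whole cone (`defect_nonneg`).

The exact constants are optimal because `g ∑ d = C f` holds with the right sign of `f` at a point of
one of the chambers: at the regular tetrahedron for the upper constant, and at a degenerate point with
`f < 0` for the lower constant. For a single edge the constants are only approached along two rays.
For opposite edges and for paths the admissible constants form a closed bounded interval because `f`
takes both signs. Outside `X_β`, the points listed in `violations` have `f > 0` and `g < 0`.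
-/

/-! ### Polynomials with natural coefficients -/

/-- Polynomials in `n` variables with natural coefficients, in recursive dense form: a polynomial in
`n + 1` variables is the list of its coefficients with respect to the variable `0`, in ascending
order. Trailing zeros are allowed, so that the representation is not unique. The operations on the
coefficient lists are written with `List.rec` because they are evaluated by the kernel, which
unfolds recursors faster than compiled pattern matching. -/
def NatPoly : ℕ → Type
  | 0 => ℕ
  | n + 1 => List (NatPoly n)

namespace NatPoly

/-- Termwise sum of two coefficient lists. -/
noncomputable def listAdd {α : Type} (add : α → α → α) (p : List α) : List α → List α :=
  List.rec (motive := fun _ => List α → List α) (fun q => q)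
    (fun a p ih q => List.rec (motive := fun _ => List α) (a :: p) (fun b q _ => add a b :: ih q) q)
    p

/-- Multiplication of all entries of a coefficient list by the same factor. -/
noncomputable def listScale {α : Type} (mul : α → α) (p : List α) : List α :=
  List.rec (motive := fun _ => List α) [] (fun a _ ih => mul a :: ih) p

/-- Convolution of two coefficient lists. -/
noncomputable def listMul {α : Type} (zero : α) (add mul : α → α → α) (p q : List α) : List α :=
  List.rec (motive := fun _ => List α) []
    (fun a _ ih => listAdd add (listScale (mul a) q) (zero :: ih)) p

/-- Termwise comparison of two coefficient lists, the second one padded with zeros. -/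
noncomputable def listLe {α : Type} (zero : α) (le : α → α → Bool) (p : List α) : List α → Bool :=
  List.rec (motive := fun _ => List α → Bool) (fun _ => true)
    (fun a _ ih q => List.rec (motive := fun _ => Bool) (le a zero && ih [])
      (fun b q _ => le a b && ih q) q) p

/-- The zero polynomial. -/
def zero : (n : ℕ) → NatPoly n
  | 0 => (0 : ℕ)
  | _ + 1 => ([] : List _)

/-- The constant polynomial `c`. -/
def const : (n : ℕ) → ℕ → NatPoly n
  | 0 => fun c => c
  | n + 1 => fun c => [const n c]

/-- The `i`-th variable. -/
def X : (n : ℕ) → Fin n → NatPoly n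
  | 0 => Fin.elim0
  | n + 1 => Fin.cases (motive := fun _ => List (NatPoly n)) [zero n, const n 1] (fun j => [X n j])

/-- The sum of two polynomials. -/
noncomputable def add : (n : ℕ) → NatPoly n → NatPoly n → NatPoly n
  | 0 => Nat.add
  | n + 1 => listAdd (add n)

/-- The product of two polynomials. -/
noncomputable def mul : (n : ℕ) → NatPoly n → NatPoly n → NatPoly n
  | 0 => Nat.mul
  | n + 1 => listMul (zero n) (add n) (mul n)

/-- Coefficientwise comparison of two polynomials. -/
noncomputable def le : (n : ℕ) → NatPoly n → NatPoly n → Bool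
  | 0 => Nat.ble
  | n + 1 => listLe (zero n) (le n)

instance (n : ℕ) : Zero (NatPoly n) := ⟨zero n⟩
noncomputable instance (n : ℕ) : Add (NatPoly n) := ⟨add n⟩
noncomputable instance (n : ℕ) : Mul (NatPoly n) := ⟨mul n⟩

/-- The value of a polynomial at a real point. -/
noncomputable def eval : (n : ℕ) → (Fin n → ℝ) → NatPoly n → ℝ
  | 0, _ => fun c => (Nat.cast c : ℝ)
  | n + 1, x => List.foldr (fun a r => eval n (Fin.tail x) a + x 0 * r) 0

/-- The polynomial with constant term `a` and quotient `p` with respect to the variable `0`. -/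
def cons {n : ℕ} (a : NatPoly n) (p : NatPoly (n + 1)) : NatPoly (n + 1) := List.cons a p

theorem cons_induction {n : ℕ} {P : NatPoly (n + 1) → Prop} (nil : P 0)
    (cons : ∀ a p, P p → P (cons a p)) (p : NatPoly (n + 1)) : P p :=
  List.rec (motive := P) nil cons p

theorem eval_cons (n : ℕ) (x : Fin (n + 1) → ℝ) (a : NatPoly n) (p : NatPoly (n + 1)) :
    eval (n + 1) x (cons a p) = eval n (Fin.tail x) a + x 0 * eval (n + 1) x p :=
  rfl

theorem eval_zero (n : ℕ) (x : Fin n → ℝ) : eval n x 0 = 0 := by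
  cases n with
  | zero => exact Nat.cast_zero
  | succ n => rfl

theorem eval_const (n : ℕ) (x : Fin n → ℝ) (c : ℕ) : eval n x (const n c) = c := by
  induction n with
  | zero => rfl
  | succ n ih =>
    change eval (n + 1) x (cons (const n c) 0) = c
    rw [eval_cons, eval_zero, ih, mul_zero, add_zero]

theorem eval_X (n : ℕ) (x : Fin n → ℝ) (i : Fin n) : eval n x (X n i) = x i := by
  induction n with
  | zero => exact i.elim0
  | succ n ih =>
    refine Fin.cases ?_ (fun j => ?_) i
    · change eval (n + 1) x (cons 0 (cons (const n 1) 0)) = x 0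
      simp [eval_cons, eval_zero, eval_const]
    · change eval (n + 1) x (cons (X n j) 0) = x j.succ
      simp [eval_cons, eval_zero, ih, Fin.tail]

theorem eval_add (n : ℕ) (x : Fin n → ℝ) (p q : NatPoly n) :
    eval n x (p + q) = eval n x p + eval n x q := by
  induction n with
  | zero => exact Nat.cast_add (R := ℝ) p q
  | succ n ih =>
    induction p using cons_induction generalizing q with
    | nil => exact (zero_add _).symm
    | cons a p ihp =>
      induction q using cons_induction with
      | nil => exact (add_zero _).symm
      | cons b q =>
        change eval (n + 1) x (cons (a + b) (p + q)) = _
        rw [eval_cons, eval_cons, eval_cons, ih, ihp]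
        ring

/-- The product of a polynomial `a` that does not contain the variable `0` and a polynomial `p`. -/
noncomputable def scale {n : ℕ} (a : NatPoly n) (p : NatPoly (n + 1)) : NatPoly (n + 1) :=
  listScale (mul n a) p

theorem eval_mul (n : ℕ) (x : Fin n → ℝ) (p q : NatPoly n) :
    eval n x (p * q) = eval n x p * eval n x q := by
  induction n with
  | zero => exact Nat.cast_mul (α := ℝ) p q
  | succ n ih =>
    have eval_scale (a : NatPoly n) (q : NatPoly (n + 1)) :
        eval (n + 1) x (scale a q) = eval n (Fin.tail x) a * eval (n + 1) x q := by
      induction q using cons_induction with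
      | nil => exact (mul_zero _).symm
      | cons b q ihq =>
        change eval (n + 1) x (cons (a * b) (scale a q)) = _
        rw [eval_cons, eval_cons, ih, ihq]
        ring
    induction p using cons_induction with
    | nil => exact (zero_mul _).symm
    | cons a p ihp =>
      change eval (n + 1) x (scale a q + cons 0 (p * q)) = _
      rw [eval_add, eval_scale, eval_cons, eval_cons, eval_zero, ihp]
      ring

/-- Coefficientwise comparison implies comparison of the values on the non-negative orthant. -/
theorem eval_le_eval (n : ℕ) (x : Fin n → ℝ) (hx : ∀ i, 0 ≤ x i) (p q : NatPoly n)
    (h : le n p q = true) : eval n x p ≤ eval n x q := by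
  induction n with
  | zero => exact Nat.cast_le.2 (Nat.le_of_ble_eq_true h)
  | succ n ih =>
    have ih' := ih (Fin.tail x) (fun i => hx i.succ)
    induction p using cons_induction generalizing q with
    | nil =>
      clear h
      have nonneg (a : NatPoly n) : 0 ≤ eval n (Fin.tail x) a := by
        have hz : le n 0 a = true := by
          cases n with
          | zero => exact Nat.ble_eq_true_of_le (Nat.zero_le _)
          | succ n => rfl
        simpa only [eval_zero] using ih' _ a hz
      rw [eval_zero]
      induction q using cons_induction with
      | nil => exact le_rfl
      | cons b q ihq => exact add_nonneg (nonneg b) (mul_nonneg (hx 0) ihq)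
    | cons a p ihp =>
      induction q using cons_induction with
      | nil =>
        have h' : (le n a 0 && le (n + 1) p 0) = true := h
        rw [Bool.and_eq_true] at h'
        have h1 := ih' _ _ h'.1
        have h2 := mul_le_mul_of_nonneg_left (ihp _ h'.2) (hx 0)
        rw [eval_zero] at h1 h2
        rw [eval_cons, eval_zero]
        linarith
      | cons b q =>
        have h' : (le n a b && le (n + 1) p q) = true := h
        rw [Bool.and_eq_true] at h'
        exact add_le_add (ih' _ _ h'.1) (mul_le_mul_of_nonneg_left (ihp _ h'.2) (hx 0))

end NatPoly

/-! ### The Cayley-Menger determinant and its partial derivatives in coordinates -/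

section Formulas

variable {R : Type} [Add R] [Mul R]

/-- The sum of the monomials of half the Cayley-Menger determinant that have positive coefficients,
in terms of the edge lengths `x`, ordered as `01, 02, 03, 12, 13, 23`. -/
def cmPos (x : Fin 6 → R) : R :=
  let q := fun k => x k * x k
  q 0 * q 5 * (q 1 + q 2 + q 3 + q 4) + q 1 * q 4 * (q 0 + q 2 + q 3 + q 5)
    + q 2 * q 3 * (q 0 + q 1 + q 4 + q 5)

/-- The sum of the monomials of half the Cayley-Menger determinant that have negative coefficients,
with the opposite sign. -/
def cmNeg (x : Fin 6 → R) : R :=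
  let q := fun k => x k * x k
  q 0 * q 5 * (q 0 + q 5) + q 1 * q 4 * (q 1 + q 4) + q 2 * q 3 * (q 2 + q 3)
    + q 0 * q 1 * q 3 + q 0 * q 2 * q 4 + q 1 * q 2 * q 5 + q 3 * q 4 * q 5

/-- The positive part of a quarter of the partial derivative with respect to the edge `x`, whose
opposite edge is `y`, and where `a, c` and `b, d` complete the two triangles at `x` and `a, d` are
opposite. -/
def partialPos (x a b c d y : R) : R :=
  x * (y * y * (a * a + b * b + c * c + d * d) + a * a * (d * d) + b * b * (c * c))

/-- The negative part of a quarter of the partial derivative, with the edges as in `partialPos`. -/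
def partialNeg (x a b c d y : R) : R :=
  x * (y * y * (x * x + x * x + y * y) + a * a * (c * c) + b * b * (d * d))

/-- The function `φ` applied to the edge `k` and the five other edges, in the order that
`partialPos` and `partialNeg` use. -/
def atEdge (φ : R → R → R → R → R → R → R) (x : Fin 6 → R) : Fin 6 → R
  | 0 => φ (x 0) (x 1) (x 2) (x 3) (x 4) (x 5)
  | 1 => φ (x 1) (x 0) (x 2) (x 3) (x 5) (x 4)
  | 2 => φ (x 2) (x 0) (x 1) (x 4) (x 5) (x 3)
  | 3 => φ (x 3) (x 0) (x 4) (x 1) (x 5) (x 2)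
  | 4 => φ (x 4) (x 0) (x 3) (x 2) (x 5) (x 1)
  | 5 => φ (x 5) (x 1) (x 3) (x 2) (x 4) (x 0)

/-- The perimeter, that is, the sum of all edge lengths. -/
def perimeter (x : Fin 6 → R) : R := x 0 + x 1 + x 2 + x 3 + x 4 + x 5

/-- The sum of `y` over the edges in `s`, for an `R` that need not be a commutative monoid. -/
def sumOver [Zero R] (s : Finset (Fin 6)) (y : Fin 6 → R) : R :=
  ([0, 1, 2, 3, 4, 5] : List (Fin 6)).foldr (fun k r => (if k ∈ s then y k else 0) + r) 0

end Formulas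

theorem sumOver_eq (s : Finset (Fin 6)) (y : Fin 6 → ℝ) : sumOver s y = ∑ k ∈ s, y k := by
  have h : ∑ k ∈ s, y k = ∑ k, if k ∈ s then y k else 0 := by simp
  rw [h]
  simp only [sumOver, Fin.sum_univ_six, List.foldr_cons, List.foldr_nil]
  ring

/-- The Cayley-Menger determinant as a function of the edge lengths. -/
def cmVal (x : Fin 6 → ℝ) : ℝ := 2 * (cmPos x - cmNeg x)

/-- The sum over `k ∈ s` of the partial derivatives of `cmVal`. -/
def cmDer (s : Finset (Fin 6)) (x : Fin 6 → ℝ) : ℝ :=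
  ∑ k ∈ s, 4 * (atEdge partialPos x k - atEdge partialNeg x k)

/-- The six edges of `K₄`, for a labelling `p` of its vertices, in the order
`01, 02, 03, 12, 13, 23`. -/
def edgeAt (p : Equiv.Perm (Fin 4)) : Fin 6 → K4Edge
  | 0 => edge p 0 1
  | 1 => edge p 0 2
  | 2 => edge p 0 3
  | 3 => edge p 1 2
  | 4 => edge p 1 3
  | 5 => edge p 2 3

theorem edgeAt_bijective : ∀ p, Function.Bijective (edgeAt p) := by decide +kernel

/-- The edge lengths of `d` with respect to the labelling `p` of the vertices. -/
def coords (p : Equiv.Perm (Fin 4)) (d : K4Edge → ℝ) (k : Fin 6) : ℝ := d (edgeAt p k)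

/-- The edges of `β`, as positions in the list `edgeAt p`. -/
def pullback (p : Equiv.Perm (Fin 4)) (β : Finset K4Edge) : Finset (Fin 6) :=
  univ.filter fun k => edgeAt p k ∈ β

theorem coords_surjective (p : Equiv.Perm (Fin 4)) : Function.Surjective (coords p) :=
  (edgeAt_bijective p).injective.surjective_comp_right

theorem sum_eq_perimeter (p : Equiv.Perm (Fin 4)) (d : K4Edge → ℝ) :
    ∑ e, d e = perimeter (coords p d) := by
  rw [← (Equiv.ofBijective _ (edgeAt_bijective p)).sum_comp]
  simp [Fin.sum_univ_succ, perimeter, coords]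
  ring

theorem len_self (d : K4Edge → ℝ) (i : Fin 4) : len d i i = 0 := by simp [len]

theorem len_comm (d : K4Edge → ℝ) (i j : Fin 4) : len d i j = len d j i := by
  unfold len
  by_cases h : i = j
  · simp [h]
  · rw [dif_neg h, dif_neg (Ne.symm h)]
    congr 2
    exact Sym2.eq_swap

theorem len_edge (d : K4Edge → ℝ) (p : Equiv.Perm (Fin 4)) (i j : Fin 4) (h : i ≠ j) :
    len d (p i) (p j) = d (edge p i j h) :=
  dif_neg (fun h' => h (p.injective h'))

/-- The table of lengths with respect to the labelling `p`. -/
theorem len_perm (d : K4Edge → ℝ) (p : Equiv.Perm (Fin 4)) (i j : Fin 4) :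
    len d (p i) (p j) = (let x := coords p d
      !![0, x 0, x 1, x 2; x 0, 0, x 3, x 4; x 1, x 3, 0, x 5; x 2, x 4, x 5, 0] i j) := by
  fin_cases i <;> fin_cases j <;>
    first
    | exact len_self d _
    | exact len_edge d p _ _ (by decide)
    | exact (len_comm d _ _).trans (len_edge d p _ _ (by decide))

/-- The matrix of squares of `L`, bordered by ones. -/
def borderedMatrix (L : Fin 4 → Fin 4 → ℝ) : Matrix (Fin 5) (Fin 5) ℝ :=
  Matrix.of (Fin.cases (Fin.cases 0 fun _ => 1) fun i => Fin.cases 1 fun j => L i j ^ 2)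

theorem cayleyMenger_eq_det (d : K4Edge → ℝ) :
    cayleyMenger d = (borderedMatrix (len d)).det := by
  unfold cayleyMenger
  congr 1
  ext i j
  fin_cases i <;> fin_cases j <;>
    first
    | rfl
    | exact (zero_pow two_ne_zero).symm.trans (congrArg (· ^ 2) (len_self d _).symm)

/-- The Cayley-Menger determinant does not depend on the labelling of the vertices. -/
theorem det_borderedMatrix_perm (L : Fin 4 → Fin 4 → ℝ) (p : Equiv.Perm (Fin 4)) :
    (borderedMatrix fun i j => L (p i) (p j)).det = (borderedMatrix L).det := by
  rw [← Matrix.det_submatrix_equiv_self (Equiv.Perm.decomposeFin.symm (0, p)) (borderedMatrix L)]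
  congr 1
  ext i j
  refine Fin.cases ?_ (fun i => ?_) i <;> refine Fin.cases ?_ (fun j => ?_) j <;>
    simp [borderedMatrix]

theorem cayleyMenger_eq (p : Equiv.Perm (Fin 4)) (d : K4Edge → ℝ) :
    cayleyMenger d = cmVal (coords p d) := by
  rw [cayleyMenger_eq_det, ← det_borderedMatrix_perm _ p]
  simp_rw [len_perm d p]
  generalize coords p d = x
  have hM : (borderedMatrix fun i j =>
      !![0, x 0, x 1, x 2; x 0, 0, x 3, x 4; x 1, x 3, 0, x 5; x 2, x 4, x 5, 0] i j)
      = !![0, 1, 1, 1, 1;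
           1, 0, x 0 ^ 2, x 1 ^ 2, x 2 ^ 2;
           1, x 0 ^ 2, 0, x 3 ^ 2, x 4 ^ 2;
           1, x 1 ^ 2, x 3 ^ 2, 0, x 5 ^ 2;
           1, x 2 ^ 2, x 4 ^ 2, x 5 ^ 2, 0] := by
    ext i j
    fin_cases i <;> fin_cases j <;>
      first
      | rfl
      | exact zero_pow two_ne_zero
  rw [hM]
  simp [Matrix.det_succ_row_zero, Fin.sum_univ_succ, Fin.succAbove, cmVal, cmPos, cmNeg]
  ring

/-- The derivative of the Cayley-Menger determinant in the direction `v`; this justifies the partial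
derivatives in `partialPos` and `partialNeg`. -/
theorem hasDerivAt_cmVal (x v : Fin 6 → ℝ) :
    HasDerivAt (fun t : ℝ => cmVal fun k => x k + t * v k)
      (∑ k, v k * (4 * (atEdge partialPos x k - atEdge partialNeg x k))) 0 := by
  have h (k : Fin 6) : HasDerivAt (fun t : ℝ => (x k + t * v k) * (x k + t * v k))
      (2 * x k * v k) 0 := by
    have h1 : HasDerivAt (fun t : ℝ => x k + t * v k) (v k) 0 :=
      (((hasDerivAt_id (0 : ℝ)).mul_const (v k)).const_add (x k)).congr_deriv (one_mul _)
    refine (h1.mul h1).congr_deriv ?_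
    ring
  have hPos := ((((h 0).mul (h 5)).mul ((((h 1).add (h 2)).add (h 3)).add (h 4))).add
    (((h 1).mul (h 4)).mul ((((h 0).add (h 2)).add (h 3)).add (h 5)))).add
    (((h 2).mul (h 3)).mul ((((h 0).add (h 1)).add (h 4)).add (h 5)))
  have hNeg := (((((((h 0).mul (h 5)).mul ((h 0).add (h 5))).add
    (((h 1).mul (h 4)).mul ((h 1).add (h 4)))).add
    (((h 2).mul (h 3)).mul ((h 2).add (h 3)))).add (((h 0).mul (h 1)).mul (h 3))).add
    (((h 0).mul (h 2)).mul (h 4))).add (((h 1).mul (h 2)).mul (h 5)) |>.add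
    (((h 3).mul (h 4)).mul (h 5))
  refine ((hPos.sub hNeg).const_mul 2).congr_deriv ?_
  simp only [Fin.sum_univ_six, atEdge, partialPos, partialNeg, Pi.add_apply, Pi.mul_apply]
  ring

theorem cayleyMengerDeriv_eq (p : Equiv.Perm (Fin 4)) (β : Finset K4Edge) (d : K4Edge → ℝ) :
    cayleyMengerDeriv β d = cmDer (pullback p β) (coords p d) := by
  have h := hasDerivAt_cmVal (coords p d) fun k => if k ∈ pullback p β then 1 else 0
  have hline (t : ℝ) : cayleyMenger (d + t • fun e => if e ∈ β then 1 else 0)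
      = cmVal fun k => coords p d k + t * if k ∈ pullback p β then 1 else 0 := by
    rw [cayleyMenger_eq p]
    congr 1
    funext k
    simp [coords, pullback]
  unfold cayleyMengerDeriv lineDeriv
  simp_rw [hline]
  rw [h.deriv, cmDer]
  simp

/-! ### Chambers as simplicial cones -/

/-- Whether the black vertex is the other endpoint of the path; if not, it is the neighbour of that
endpoint along the path. -/
def Decoration.far (D : Decoration) : Bool := decide (D.black = D.path 3)

theorem Decoration.black_eq (D : Decoration) : D.black = D.path (if D.far then 3 else 2) := by
  have h : D.black = D.path 2 ∨ D.black = D.path 3 := D.2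
  by_cases h3 : D.black = D.path 3
  · simp [far, h3]
  · simp [far, h.resolve_right h3]

/-- The linear map whose columns generate a chamber: the columns are the edge labellings
`(2, 1, 1, 1, 1, 2)`, `(1, 0, 1, 1, 0, 1)`, `(2, 1, 1, 1, 1, 0)`, the indicator vector of the edges
at the vertex next to the white one, the indicator vector of the edges at the vertex that is neither
black nor one of these two, and the all-ones vector. -/
def coneMap {R : Type} [Zero R] [Add R] (far : Bool) (t : Fin 6 → R) : Fin 6 → R
  | 0 => t 0 + t 0 + t 1 + t 2 + t 2 + t 3 + t 5
  | 1 => t 0 + t 2 + (if far then t 4 else 0) + t 5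
  | 2 => t 0 + t 1 + t 2 + (if far then 0 else t 4) + t 5
  | 3 => t 0 + t 1 + t 2 + t 3 + (if far then t 4 else 0) + t 5
  | 4 => t 0 + t 2 + t 3 + (if far then 0 else t 4) + t 5
  | 5 => t 0 + t 0 + t 1 + t 4 + t 5

theorem vertexSum_perm (d : K4Edge → ℝ) (p : Equiv.Perm (Fin 4)) (v : Fin 4) :
    vertexSum d (p v) = (let x := coords p d
      ![x 0 + x 1 + x 2, x 0 + x 3 + x 4, x 1 + x 3 + x 5, x 2 + x 4 + x 5] v) := by
  rw [vertexSum, ← Equiv.sum_comp p]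
  simp_rw [len_perm d p]
  fin_cases v <;> simp [Fin.sum_univ_four]

theorem mem_pseudoTetrahedra_iff (p : Equiv.Perm (Fin 4)) (d : K4Edge → ℝ) :
    d ∈ pseudoTetrahedra ↔ (∀ k, 0 ≤ coords p d k) ∧ ∀ i j k : Fin 4, i ≠ j → j ≠ k → i ≠ k →
      len d (p i) (p k) ≤ len d (p i) (p j) + len d (p j) (p k) := by
  refine and_congr ?_ ?_
  · exact (edgeAt_bijective p).surjective.forall
  · refine p.surjective.forall.trans (forall_congr' fun i => p.surjective.forall.trans
      (forall_congr' fun j => p.surjective.forall.trans (forall_congr' fun k => ?_)))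
    simp only [ne_eq, EmbeddingLike.apply_eq_iff_eq]

/-- In the coordinates given by the path, a chamber is the simplicial cone of `coneMap`. The twelve
triangle inequalities follow from the one with the black vertex as apex and the path's outer pair
as the axis that contains the opposite side, since that axis sum is maximal and that vertex sum is
minimal. The cone parameters are half the differences in the inequalities between the axis sums
and between the vertex sums, and the slack of that triangle inequality. -/
theorem mem_chamber_iff (D : Decoration) (d : K4Edge → ℝ) :
    d ∈ D.chamber ↔ ∃ t : Fin 6 → ℝ, (∀ k, 0 ≤ t k) ∧ coords D.path d = coneMap D.far t := by
  have hmem : d ∈ D.chamber ↔ d ∈ pseudoTetrahedra ∧ _ := Iff.rfl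
  have hblack : (∀ v, vertexSum d D.black ≤ vertexSum d v)
      ↔ ∀ v, vertexSum d D.black ≤ vertexSum d (D.path v) := D.path.surjective.forall
  rw [hmem, mem_pseudoTetrahedra_iff D.path, hblack]
  simp only [Decoration.black_eq, Decoration.white, Decoration.whiteNeighbor, axisSum,
    vertexSum_perm, len_perm d D.path]
  generalize coords D.path d = x
  generalize D.far = far
  constructor
  · rintro ⟨⟨-, htri⟩, h1, h2, hb, hw⟩
    cases far
    · have h3 := htri 0 2 1 (by decide) (by decide) (by decide)
      have hb0 := hb 0
      have hb3 := hb 3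
      simp at h1 h2 h3 hb0 hb3 hw
      refine ⟨![(x 0 + x 5 - x 2 - x 3) / 2, (x 2 + x 3 - x 1 - x 4) / 2,
        (x 0 + x 2 - x 3 - x 5) / 2, (x 3 + x 4 - x 1 - x 2) / 2, (x 2 + x 4 - x 1 - x 3) / 2,
        x 1 + x 3 - x 0], fun k => ?_, funext fun k => ?_⟩
      · fin_cases k <;> simp <;> linarith
      · fin_cases k <;> simp [coneMap] <;> ring
    · have h3 := htri 0 3 1 (by decide) (by decide) (by decide)
      have hb0 := hb 0
      have hb2 := hb 2
      simp at h1 h2 h3 hb0 hb2 hw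
      refine ⟨![(x 0 + x 5 - x 2 - x 3) / 2, (x 2 + x 3 - x 1 - x 4) / 2,
        (x 0 + x 1 - x 4 - x 5) / 2, (x 3 + x 4 - x 1 - x 2) / 2, (x 1 + x 3 - x 2 - x 4) / 2,
        x 2 + x 4 - x 0], fun k => ?_, funext fun k => ?_⟩
      · fin_cases k <;> simp <;> linarith
      · fin_cases k <;> simp [coneMap] <;> ring
  · rintro ⟨t, ht, rfl⟩
    have := ht 0; have := ht 1; have := ht 2; have := ht 3; have := ht 4; have := ht 5
    cases far
    all_goals
      refine ⟨⟨fun k => ?_, fun i j k hij hjk hik => ?_⟩, ?_, ?_, fun v => ?_, ?_⟩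
      · fin_cases k <;> simp [coneMap] <;> linarith
      · fin_cases i <;> fin_cases j <;> fin_cases k <;>
          first
          | exact absurd rfl hij
          | exact absurd rfl hjk
          | exact absurd rfl hik
          | (simp [coneMap]; linarith)
      · simp [coneMap]; linarith
      · simp [coneMap]; linarith
      · fin_cases v <;> simp [coneMap] <;> linarith
      · simp [coneMap]; linarith

/-- For every vertex `b` there is a labelling of the vertices that puts `b` in position `2` and the
three axis sums into the order of a chamber: the six labellings with `b` in position `2` realize the
six orders of the axes. -/
theorem exists_axes_sorted (d : K4Edge → ℝ) (b : Fin 4) : ∃ p : Equiv.Perm (Fin 4), p 2 = b ∧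
    axisSum d (p 0) (p 3) (p 1) (p 2) ≤ axisSum d (p 0) (p 1) (p 2) (p 3) ∧
    axisSum d (p 0) (p 2) (p 1) (p 3) ≤ axisSum d (p 0) (p 3) (p 1) (p 2) := by
  obtain ⟨q, hq⟩ : ∃ q : Equiv.Perm (Fin 4), q 2 = b := ⟨Equiv.swap 2 b, Equiv.swap_apply_left _ _⟩
  suffices h : ∃ i j k, ∃ s : Equiv.Perm (Fin 4), s 0 = i ∧ s 1 = j ∧ s 2 = 2 ∧ s 3 = k ∧
      axisSum d (q i) (q k) (q j) (q 2) ≤ axisSum d (q i) (q j) (q 2) (q k) ∧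
      axisSum d (q i) (q 2) (q j) (q k) ≤ axisSum d (q i) (q k) (q j) (q 2) by
    obtain ⟨i, j, k, s, rfl, rfl, h2, rfl, h⟩ := h
    refine ⟨q * s, by simp [h2, hq], ?_⟩
    simpa only [Equiv.Perm.mul_apply, h2] using h
  simp only [axisSum, len_perm d q]
  generalize coords q d = x
  rcases le_total (x 2 + x 3) (x 0 + x 5) with h1 | h1 <;>
    rcases le_total (x 1 + x 4) (x 0 + x 5) with h2 | h2 <;>
    rcases le_total (x 1 + x 4) (x 2 + x 3) with h3 | h3
  · refine ⟨0, 1, 3, 1, by decide, by decide, by decide, by decide, ?_, ?_⟩ <;> simp <;> linarith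
  · refine ⟨1, 0, 3, Equiv.swap 0 1, by decide, by decide, by decide, by decide, ?_, ?_⟩ <;>
      simp <;> linarith
  · refine ⟨0, 1, 3, 1, by decide, by decide, by decide, by decide, ?_, ?_⟩ <;> simp <;> linarith
  · refine ⟨1, 3, 0, Equiv.swap 0 1 * Equiv.swap 1 3, by decide, by decide, by decide, by decide,
      ?_, ?_⟩ <;> simp <;> linarith
  · refine ⟨0, 3, 1, Equiv.swap 1 3, by decide, by decide, by decide, by decide, ?_, ?_⟩ <;>
      simp <;> linarith
  · refine ⟨0, 1, 3, 1, by decide, by decide, by decide, by decide, ?_, ?_⟩ <;> simp <;> linarith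
  · refine ⟨3, 0, 1, Equiv.swap 0 3 * Equiv.swap 1 3, by decide, by decide, by decide, by decide,
      ?_, ?_⟩ <;> simp <;> linarith
  · refine ⟨3, 1, 0, Equiv.swap 0 3, by decide, by decide, by decide, by decide, ?_, ?_⟩ <;>
      simp <;> linarith

/-- The chambers cover the cone of pseudo-tetrahedra. -/
theorem chamberUnion_univ : chamberUnion univ = pseudoTetrahedra := by
  apply Set.Subset.antisymm
  · exact Set.iUnion₂_subset fun D _ d hd => hd.1
  · intro d hd
    obtain ⟨b, hb⟩ := Finite.exists_min (vertexSum d)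
    obtain ⟨p, rfl, h1, h2⟩ := exists_axes_sorted d b
    rcases le_total (vertexSum d (p 0)) (vertexSum d (p 1)) with hw | hw
    · exact Set.mem_iUnion₂.2 ⟨⟨(p, p 2), Or.inl rfl⟩, mem_univ _, hd, h1, h2, hb, hw⟩
    · -- Reversing both outer edges of the path preserves the axes and exchanges the white vertex
      -- with its neighbour; the black vertex becomes the endpoint of the path.
      let r : Equiv.Perm (Fin 4) := p * (Equiv.swap 0 1 * Equiv.swap 2 3)
      have r0 : r 0 = p 1 := congrArg p (by decide)
      have r1 : r 1 = p 0 := congrArg p (by decide)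
      have r2 : r 2 = p 3 := congrArg p (by decide)
      have r3 : r 3 = p 2 := congrArg p (by decide)
      refine Set.mem_iUnion₂.2 ⟨⟨(r, p 2), Or.inr r3.symm⟩, mem_univ _, hd, ?_, ?_, hb, ?_⟩
      · change axisSum d (r 0) (r 3) (r 1) (r 2) ≤ axisSum d (r 0) (r 1) (r 2) (r 3)
        rw [r0, r1, r2, r3]
        simp only [axisSum, len_comm d (p 1) (p 0), len_comm d (p 3) (p 2)] at h1 ⊢
        linarith
      · change axisSum d (r 0) (r 2) (r 1) (r 3) ≤ axisSum d (r 0) (r 3) (r 1) (r 2)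
        rw [r0, r1, r2, r3]
        simp only [axisSum] at h2 ⊢
        linarith
      · change vertexSum d (r 0) ≤ vertexSum d (r 1)
        rwa [r0, r1]

/-! ### Positivity certificates -/

/-- The coordinates of `coneMap` as polynomials in the first five cone parameters, where the last one
is set to `1`. -/
noncomputable def conePoly (far : Bool) : Fin 6 → NatPoly 5 :=
  coneMap far (Fin.snoc (α := fun _ => NatPoly 5) (NatPoly.X 5) (NatPoly.const 5 1))

/-- Certificate for the non-negativity of `g ∑ d - C f` on a chamber, where `g` is the derivative
along the edges in `s` and `C = m - n`: after subtraction of `c (a - b) ^ 2`, half of this polynomial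
has non-negative coefficients in the cone parameters, the last of which is set to `1`. The terms
with negative signs are moved to the left-hand side of the comparison. -/
noncomputable def certifies (far : Bool) (s : Finset (Fin 6)) (m n : ℕ) (c a b : NatPoly 5) :
    Bool :=
  let x := conePoly far
  NatPoly.le 5
    (sumOver s (fun k => (atEdge partialNeg x k + atEdge partialNeg x k) * perimeter x)
      + NatPoly.const 5 m * cmPos x + NatPoly.const 5 n * cmNeg x + c * (a * a + b * b))
    (sumOver s (fun k => (atEdge partialPos x k + atEdge partialPos x k) * perimeter x)
      + NatPoly.const 5 m * cmNeg x + NatPoly.const 5 n * cmPos x + c * (a * b + a * b))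

/-- The function `g ∑ d - C f` on a chamber, in terms of the cone parameters. -/
noncomputable def defect (far : Bool) (s : Finset (Fin 6)) (C : ℝ) (t : Fin 6 → ℝ) : ℝ :=
  cmDer s (coneMap far t) * perimeter (coneMap far t) - C * cmVal (coneMap far t)

theorem eval_conePoly (far : Bool) (u : Fin 5 → ℝ) (k : Fin 6) :
    NatPoly.eval 5 u (conePoly far k) = coneMap far (Fin.snoc (α := fun _ => ℝ) u 1) k := by
  have h (i : Fin 6) : NatPoly.eval 5 u (Fin.snoc (α := fun _ => NatPoly 5) (NatPoly.X 5)
      (NatPoly.const 5 1) i) = Fin.snoc (α := fun _ => ℝ) u 1 i := by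
    refine Fin.lastCases ?_ (fun i => ?_) i
    · rw [Fin.snoc_last, Fin.snoc_last, NatPoly.eval_const, Nat.cast_one]
    · rw [Fin.snoc_castSucc, Fin.snoc_castSucc, NatPoly.eval_X]
  unfold conePoly
  cases far <;> fin_cases k <;>
    simp only [coneMap, Bool.false_eq_true, if_false, if_true, NatPoly.eval_add, NatPoly.eval_zero,
      h]

theorem eval_sumOver (s : Finset (Fin 6)) (u : Fin 5 → ℝ) (y : Fin 6 → NatPoly 5) :
    NatPoly.eval 5 u (sumOver s y) = ∑ k ∈ s, NatPoly.eval 5 u (y k) := by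
  rw [← sumOver_eq]
  simp only [sumOver, List.foldr_cons, List.foldr_nil, NatPoly.eval_add, NatPoly.eval_zero,
    apply_ite (NatPoly.eval 5 u)]

theorem eval_atEdge_partialPos (u : Fin 5 → ℝ) (x : Fin 6 → NatPoly 5) (k : Fin 6) :
    NatPoly.eval 5 u (atEdge partialPos x k)
      = atEdge partialPos (fun i => NatPoly.eval 5 u (x i)) k := by
  fin_cases k <;> simp only [atEdge, partialPos, NatPoly.eval_add, NatPoly.eval_mul]

theorem eval_atEdge_partialNeg (u : Fin 5 → ℝ) (x : Fin 6 → NatPoly 5) (k : Fin 6) :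
    NatPoly.eval 5 u (atEdge partialNeg x k)
      = atEdge partialNeg (fun i => NatPoly.eval 5 u (x i)) k := by
  fin_cases k <;> simp only [atEdge, partialNeg, NatPoly.eval_add, NatPoly.eval_mul]

theorem defect_snoc_nonneg {far : Bool} {s : Finset (Fin 6)} {m n : ℕ} {c a b : NatPoly 5}
    (h : certifies far s m n c a b = true) (u : Fin 5 → ℝ) (hu : ∀ i, 0 ≤ u i) :
    0 ≤ defect far s (m - n) (Fin.snoc (α := fun _ => ℝ) u 1) := by
  have hle := NatPoly.eval_le_eval 5 u hu _ _ h
  have hc : 0 ≤ NatPoly.eval 5 u c := by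
    have := NatPoly.eval_le_eval 5 u hu 0 c rfl
    rwa [NatPoly.eval_zero] at this
  have hsq := mul_nonneg hc (sq_nonneg (NatPoly.eval 5 u a - NatPoly.eval 5 u b))
  simp only [NatPoly.eval_add, NatPoly.eval_mul, eval_sumOver, eval_atEdge_partialPos,
    eval_atEdge_partialNeg, NatPoly.eval_const, cmPos, cmNeg, perimeter, ← Finset.sum_mul,
    eval_conePoly] at hle
  simp only [defect, cmDer, cmVal, cmPos, cmNeg, perimeter, ← Finset.mul_sum,
    Finset.sum_sub_distrib]
  simp only [Finset.sum_add_distrib] at hle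
  generalize coneMap far (Fin.snoc (α := fun _ => ℝ) u 1) = x at *
  generalize ∑ k ∈ s, atEdge partialPos (fun i => x i) k = P at *
  generalize ∑ k ∈ s, atEdge partialNeg (fun i => x i) k = N at *
  nlinarith

theorem defect_smul (far : Bool) (s : Finset (Fin 6)) (C r : ℝ) (t : Fin 6 → ℝ) :
    defect far s C (r • t) = r ^ 6 * defect far s C t := by
  have hcone : coneMap far (r • t) = r • coneMap far t := by
    funext k
    cases far <;> fin_cases k <;> simp [coneMap] <;> ring
  have hder (k : Fin 6) (x : Fin 6 → ℝ) : atEdge partialPos (r • x) k - atEdge partialNeg (r • x) k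
      = r ^ 5 * (atEdge partialPos x k - atEdge partialNeg x k) := by
    fin_cases k <;> simp only [atEdge, partialPos, partialNeg, Pi.smul_apply, smul_eq_mul] <;> ring
  simp only [defect, cmDer, hcone, hder, cmVal, cmPos, cmNeg, perimeter, Pi.smul_apply,
    smul_eq_mul, mul_left_comm _ (r ^ 5), ← Finset.mul_sum]
  ring

theorem continuous_defect (far : Bool) (s : Finset (Fin 6)) (C : ℝ) :
    Continuous (defect far s C) := by
  have hcone (k : Fin 6) : Continuous fun t : Fin 6 → ℝ => coneMap far t k := by
    cases far <;> fin_cases k <;> simp [coneMap] <;> fun_prop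
  have hder (k : Fin 6) : Continuous fun t : Fin 6 → ℝ =>
      4 * (atEdge partialPos (coneMap far t) k - atEdge partialNeg (coneMap far t) k) := by
    fin_cases k <;> simp only [atEdge, partialPos, partialNeg] <;> fun_prop
  have hsum : Continuous fun t : Fin 6 → ℝ => cmDer s (coneMap far t) :=
    continuous_finsetSum s fun k _ => hder k
  unfold defect cmVal cmPos cmNeg perimeter
  fun_prop

/-- The certificate only concerns the points with last cone parameter `1`; the other points are
reached by homogeneity and continuity. -/
theorem defect_nonneg {far : Bool} {s : Finset (Fin 6)} {m n : ℕ} {c a b : NatPoly 5}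
    (h : certifies far s m n c a b = true) (t : Fin 6 → ℝ) (ht : ∀ i, 0 ≤ t i) :
    0 ≤ defect far s (m - n) t := by
  have hpos (t : Fin 6 → ℝ) (ht : ∀ i, 0 ≤ t i) (h5 : 0 < t 5) :
      0 ≤ defect far s (m - n) t := by
    have hsnoc : t = t 5 • Fin.snoc (α := fun _ => ℝ) (fun i => t i.castSucc / t 5) 1 := by
      funext i
      refine Fin.lastCases ?_ (fun i => ?_) i
      · rw [Pi.smul_apply, Fin.snoc_last, smul_eq_mul, mul_one]
        rfl
      · simp [mul_div_cancel₀ _ h5.ne']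
    rw [hsnoc, defect_smul]
    exact mul_nonneg (by positivity)
      (defect_snoc_nonneg h _ fun i => div_nonneg (ht _) h5.le)
  have hcont : Continuous fun ε : ℝ => defect far s (m - n) fun i => t i + ε :=
    (continuous_defect far s _).comp (by fun_prop)
  have hlim := (hcont.tendsto 0).mono_left (nhdsWithin_le_nhds (s := Set.Ioi 0))
  simp only [add_zero] at hlim
  refine ge_of_tendsto hlim (Filter.eventually_of_mem self_mem_nhdsWithin fun ε hε => ?_)
  exact hpos _ (fun i => add_nonneg (ht i) (le_of_lt hε)) (add_pos_of_nonneg_of_pos (ht 5) hε)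

/-! ### Passage between chambers and cone parameters -/

/-- The position of the chamber of `D` relative to the edge set `β`, up to relabelling of the
vertices: the position of the black vertex, and the edges of `β` in the coordinates given by the
path. -/
def relPos (β : Finset K4Edge) (D : Decoration) : Bool × Finset (Fin 6) :=
  (D.far, pullback D.path β)

theorem exists_mem_chamber (D : Decoration) (t : Fin 6 → ℝ) (ht : ∀ k, 0 ≤ t k) :
    ∃ d ∈ D.chamber, coords D.path d = coneMap D.far t := by
  obtain ⟨d, hd⟩ := coords_surjective D.path (coneMap D.far t)
  exact ⟨d, (mem_chamber_iff D d).2 ⟨t, ht, hd⟩, hd⟩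

theorem sub_eq_defect {D : Decoration} {d : K4Edge → ℝ} {t : Fin 6 → ℝ}
    (h : coords D.path d = coneMap D.far t) (β : Finset K4Edge) (C : ℝ) :
    cayleyMengerDeriv β d * (∑ e, d e) - C * cayleyMenger d
      = defect (relPos β D).1 (relPos β D).2 C t := by
  rw [cayleyMengerDeriv_eq D.path, cayleyMenger_eq D.path, sum_eq_perimeter D.path, h]
  rfl

theorem nonneg_of_certifies {β : Finset K4Edge} {S : Finset Decoration}
    {good : List (Bool × Finset (Fin 6))} (hgood : ∀ D ∈ S, relPos β D ∈ good) {m n : ℕ}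
    {c a b : NatPoly 5} (h : ∀ r ∈ good, certifies r.1 r.2 m n c a b = true) :
    ∀ d ∈ chamberUnion S,
      0 ≤ cayleyMengerDeriv β d * (∑ e, d e) - ((m : ℝ) - n) * cayleyMenger d := by
  intro d hd
  obtain ⟨D, hD, hd⟩ := Set.mem_iUnion₂.1 hd
  obtain ⟨t, ht, hdt⟩ := (mem_chamber_iff D d).1 hd
  rw [sub_eq_defect hdt]
  exact defect_nonneg (h _ (hgood D hD)) t ht

theorem cast_sumOver (s : Finset (Fin 6)) (y : Fin 6 → ℕ) :
    ((sumOver s y : ℕ) : ℝ) = ∑ k ∈ s, (y k : ℝ) := by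
  rw [← sumOver_eq]
  simp [sumOver]

theorem cast_coneMap (far : Bool) (t : Fin 6 → ℕ) (k : Fin 6) :
    ((coneMap far t k : ℕ) : ℝ) = coneMap far (fun i => (t i : ℝ)) k := by
  cases far <;> fin_cases k <;> simp [coneMap]

theorem cast_cmPos (far : Bool) (t : Fin 6 → ℕ) :
    ((cmPos (coneMap far t) : ℕ) : ℝ) = cmPos (coneMap far fun i => (t i : ℝ)) := by
  simp only [cmPos, Nat.cast_add, Nat.cast_mul, cast_coneMap]

theorem cast_cmNeg (far : Bool) (t : Fin 6 → ℕ) :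
    ((cmNeg (coneMap far t) : ℕ) : ℝ) = cmNeg (coneMap far fun i => (t i : ℝ)) := by
  simp only [cmNeg, Nat.cast_add, Nat.cast_mul, cast_coneMap]

theorem cast_partialPos (far : Bool) (t : Fin 6 → ℕ) (k : Fin 6) :
    ((atEdge partialPos (coneMap far t) k : ℕ) : ℝ)
      = atEdge partialPos (coneMap far fun i => (t i : ℝ)) k := by
  fin_cases k <;> simp only [atEdge, partialPos, Nat.cast_add, Nat.cast_mul, cast_coneMap]

theorem cast_partialNeg (far : Bool) (t : Fin 6 → ℕ) (k : Fin 6) :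
    ((atEdge partialNeg (coneMap far t) k : ℕ) : ℝ)
      = atEdge partialNeg (coneMap far fun i => (t i : ℝ)) k := by
  fin_cases k <;> simp only [atEdge, partialNeg, Nat.cast_add, Nat.cast_mul, cast_coneMap]

theorem cast_perimeter (far : Bool) (t : Fin 6 → ℕ) :
    ((perimeter (coneMap far t) : ℕ) : ℝ) = perimeter (coneMap far fun i => (t i : ℝ)) := by
  simp only [perimeter, Nat.cast_add, cast_coneMap]

/-- The Cayley-Menger determinant is positive and the derivative along `s` is negative at the point
with cone parameters `t`. -/
def IsViolation (far : Bool) (s : Finset (Fin 6)) (t : Fin 6 → ℕ) : Prop :=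
  let x := coneMap far t
  cmNeg x < cmPos x ∧ sumOver s (atEdge partialPos x) < sumOver s (atEdge partialNeg x)

instance (far : Bool) (s : Finset (Fin 6)) (t : Fin 6 → ℕ) : Decidable (IsViolation far s t) :=
  inferInstanceAs (Decidable (_ ∧ _))

theorem IsViolation.exists {β : Finset K4Edge} {D : Decoration} {t : Fin 6 → ℕ}
    (h : IsViolation (relPos β D).1 (relPos β D).2 t) :
    ∃ d ∈ D.chamber, 0 < cayleyMenger d ∧ cayleyMengerDeriv β d < 0 := by
  obtain ⟨d, hd, hx⟩ := exists_mem_chamber D (fun k => t k) fun k => Nat.cast_nonneg _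
  have h1 := (Nat.cast_lt (α := ℝ)).2 h.1
  have h2 := (Nat.cast_lt (α := ℝ)).2 h.2
  refine ⟨d, hd, ?_, ?_⟩
  · rw [cayleyMenger_eq D.path, hx, cmVal]
    rw [cast_cmPos, cast_cmNeg] at h1
    simp only [relPos] at h1
    linarith
  · rw [cayleyMengerDeriv_eq D.path, hx, cmDer, ← Finset.mul_sum, Finset.sum_sub_distrib]
    simp only [cast_sumOver, cast_partialPos, cast_partialNeg, relPos] at h2
    linarith

/-- `g ∑ d = (m - n) f` at the point with cone parameters `t`, where `g` is the derivative along `s`.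
The common factor `2` is dropped, and the terms are distributed so that all signs are positive. -/
def HasRatio (far : Bool) (s : Finset (Fin 6)) (t : Fin 6 → ℕ) (m n : ℕ) : Prop :=
  let x := coneMap far t
  2 * sumOver s (atEdge partialPos x) * perimeter x + m * cmNeg x + n * cmPos x
    = 2 * sumOver s (atEdge partialNeg x) * perimeter x + m * cmPos x + n * cmNeg x

instance (far : Bool) (s : Finset (Fin 6)) (t : Fin 6 → ℕ) (m n : ℕ) :
    Decidable (HasRatio far s t m n) :=
  inferInstanceAs (Decidable (_ = _))

theorem HasRatio.defect_eq {far : Bool} {s : Finset (Fin 6)} {t : Fin 6 → ℕ} {m n : ℕ}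
    (h : HasRatio far s t m n) (C : ℝ) :
    defect far s C (fun k => t k) = (m - n - C) * cmVal (coneMap far fun k => (t k : ℝ)) := by
  have h' := congrArg (Nat.cast (R := ℝ)) h
  simp only [Nat.cast_add, Nat.cast_mul, cast_sumOver, cast_partialPos, cast_partialNeg,
    cast_perimeter, cast_cmPos, cast_cmNeg, Nat.cast_ofNat] at h'
  rw [defect, cmDer, ← Finset.mul_sum, Finset.sum_sub_distrib, cmVal]
  linear_combination 2 * h'

/-! ### Sharp constants -/

/-- Criterion for sharp constants: the inequality holds at both endpoints and fails outside. -/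
theorem hasSharpConstants_of {β : Finset K4Edge} {S : Finset Decoration} {A B : ℝ} (hAB : A < B)
    (hB : 0 < B)
    (hA' : ∀ d ∈ chamberUnion S, 0 ≤ cayleyMengerDeriv β d * (∑ e, d e) - A * cayleyMenger d)
    (hB' : ∀ d ∈ chamberUnion S, 0 ≤ cayleyMengerDeriv β d * (∑ e, d e) - B * cayleyMenger d)
    (hlt : ∀ C < A, ∃ d ∈ chamberUnion S,
      cayleyMengerDeriv β d * (∑ e, d e) - C * cayleyMenger d < 0)
    (hgt : ∀ C > B, ∃ d ∈ chamberUnion S,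
      cayleyMengerDeriv β d * (∑ e, d e) - C * cayleyMenger d < 0)
    (hout : ∀ D : Decoration, D ∉ S →
      ∃ d ∈ D.chamber, 0 < cayleyMenger d ∧ cayleyMengerDeriv β d < 0) :
    HasSharpConstants β S A B := by
  refine ⟨hAB, hB, fun C => ⟨fun h => ⟨?_, ?_⟩, fun hC d hd => ?_⟩, hout⟩
  · by_contra! hC
    obtain ⟨d, hd, hneg⟩ := hlt C hC
    exact absurd (h d hd) hneg.not_ge
  · by_contra! hC
    obtain ⟨d, hd, hneg⟩ := hgt C hC
    exact absurd (h d hd) hneg.not_ge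
  · -- The expression is affine in `C`, so that the two endpoints suffice.
    have h1 := hA' d hd
    have h2 := hB' d hd
    rcases le_total 0 (cayleyMenger d) with h0 | h0
    · linarith [mul_le_mul_of_nonneg_right hC.2 h0]
    · linarith [mul_le_mul_of_nonpos_right hC.1 h0]

/-- If the inequality holds for two constants and the Cayley-Menger determinant takes both signs on
the union of the chambers, then the admissible constants form a compact interval. -/
theorem exists_hasSharpConstants {β : Finset K4Edge} {S : Finset Decoration} {A B : ℝ} (hAB : A < B)
    (hB : 0 < B)
    (hA' : ∀ d ∈ chamberUnion S, 0 ≤ cayleyMengerDeriv β d * (∑ e, d e) - A * cayleyMenger d)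
    (hB' : ∀ d ∈ chamberUnion S, 0 ≤ cayleyMengerDeriv β d * (∑ e, d e) - B * cayleyMenger d)
    (hneg : ∃ d ∈ chamberUnion S, cayleyMenger d < 0)
    (hpos : ∃ d ∈ chamberUnion S, 0 < cayleyMenger d)
    (hout : ∀ D : Decoration, D ∉ S →
      ∃ d ∈ D.chamber, 0 < cayleyMenger d ∧ cayleyMengerDeriv β d < 0) :
    ∃ A' B' : ℝ, A' ≤ A ∧ B ≤ B' ∧ HasSharpConstants β S A' B' := by
  obtain ⟨d₁, hd₁, hf₁⟩ := hneg
  obtain ⟨d₂, hd₂, hf₂⟩ := hpos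
  let K : Set ℝ := {C | ∀ d ∈ chamberUnion S,
    0 ≤ cayleyMengerDeriv β d * (∑ e, d e) - C * cayleyMenger d}
  have hAK : A ∈ K := hA'
  have hBK : B ∈ K := hB'
  have hclosed : IsClosed K := by
    have : K = ⋂ d ∈ chamberUnion S,
        {C | 0 ≤ cayleyMengerDeriv β d * (∑ e, d e) - C * cayleyMenger d} := by
      ext C
      simp [K]
    rw [this]
    exact isClosed_biInter fun d _ => isClosed_le continuous_const (by fun_prop)
  have hbelow : BddBelow K :=
    ⟨cayleyMengerDeriv β d₁ * (∑ e, d₁ e) / cayleyMenger d₁, fun C hC => by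
      rw [div_le_iff_of_neg hf₁]
      linarith [hC d₁ hd₁]⟩
  have habove : BddAbove K :=
    ⟨cayleyMengerDeriv β d₂ * (∑ e, d₂ e) / cayleyMenger d₂, fun C hC => by
      rw [le_div_iff₀ hf₂]
      linarith [hC d₂ hd₂]⟩
  have hA := csInf_le hbelow hAK
  have hB₂ := le_csSup habove hBK
  have outside {C : ℝ} (hC : C ∉ K) : ∃ d ∈ chamberUnion S,
      cayleyMengerDeriv β d * (∑ e, d e) - C * cayleyMenger d < 0 := by
    by_contra! h
    exact hC h
  exact ⟨sInf K, sSup K, hA, hB₂, hasSharpConstants_of (by linarith) (by linarith)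
    (hclosed.csInf_mem ⟨A, hAK⟩ hbelow) (hclosed.csSup_mem ⟨A, hAK⟩ habove)
    (fun C hC => outside fun h => hC.not_ge (csInf_le hbelow h))
    (fun C hC => outside fun h => (show sSup K < C from hC).not_ge (le_csSup habove h)) hout⟩

/-! ### Relabelling the vertices -/

/-- The action of a permutation of the vertices on the edges. -/
def relabelEdge (p : Equiv.Perm (Fin 4)) (e : K4Edge) : K4Edge :=
  ⟨e.1.map p, fun h => e.2 ((Sym2.isDiag_map p.injective).1 h)⟩

/-- The action of a permutation of the vertices on the decorations. -/
def relabel (p : Equiv.Perm (Fin 4)) (D : Decoration) : Decoration :=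
  ⟨(p * D.path, p D.black), D.2.imp (congrArg p) (congrArg p)⟩

theorem relabelEdge_edge (p q : Equiv.Perm (Fin 4)) (i j : Fin 4) (h : i ≠ j) :
    relabelEdge p (edge q i j h) = edge (p * q) i j h := rfl

theorem relabelEdge_injective (p : Equiv.Perm (Fin 4)) : Function.Injective (relabelEdge p) :=
  fun _ _ h => Subtype.ext (Sym2.map.injective p.injective (congrArg Subtype.val h))

theorem relabel_injective (p : Equiv.Perm (Fin 4)) : Function.Injective (relabel p) := by
  intro D D' h
  have h' := congrArg Subtype.val h
  exact Subtype.ext (Prod.ext (mul_left_cancel (congrArg Prod.fst h'))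
    (p.injective (congrArg Prod.snd h')))

theorem relabel_surjective (p : Equiv.Perm (Fin 4)) : Function.Surjective (relabel p) :=
  Finite.surjective_of_injective (relabel_injective p)

theorem edges_relabel (p : Equiv.Perm (Fin 4)) (D : Decoration) :
    (relabel p D).edges = D.edges.image (relabelEdge p) := by
  simp only [Decoration.edges, image_insert, image_singleton, relabelEdge_edge]
  rfl

theorem outerEdges_relabel (p : Equiv.Perm (Fin 4)) (D : Decoration) :
    (relabel p D).outerEdges = D.outerEdges.image (relabelEdge p) := by
  simp only [Decoration.outerEdges, image_insert, image_singleton, relabelEdge_edge]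
  rfl

theorem black_relabel (p : Equiv.Perm (Fin 4)) (D : Decoration) :
    (relabel p D).black = p D.black := rfl

theorem apply_mem_relabelEdge (p : Equiv.Perm (Fin 4)) (v : Fin 4) (e : K4Edge) :
    p v ∈ (relabelEdge p e).1 ↔ v ∈ e.1 := by
  simp [relabelEdge, Sym2.mem_map]

theorem relPos_relabel (p : Equiv.Perm (Fin 4)) (β : Finset K4Edge) (D : Decoration) :
    relPos (β.image (relabelEdge p)) (relabel p D) = relPos β D := by
  have hfar : (relabel p D).far = D.far :=
    decide_eq_decide.2 p.injective.eq_iff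
  have hedge (k : Fin 6) : edgeAt (relabel p D).path k = relabelEdge p (edgeAt D.path k) := by
    fin_cases k <;> rfl
  refine Prod.ext hfar (Finset.filter_congr fun k _ => ?_)
  rw [hedge, (relabelEdge_injective p).mem_finset_image]

theorem eq_image_relabel (p : Equiv.Perm (Fin 4)) {P Q : Decoration → Prop} [DecidablePred Q]
    {S : Finset Decoration} (hS : (S : Set Decoration) = {D | P D})
    (h : ∀ D, P (relabel p D) ↔ Q D) : S = (univ.filter Q).image (relabel p) := by
  ext D
  obtain ⟨D, rfl⟩ := relabel_surjective p D
  rw [(relabel_injective p).mem_finset_image, mem_filter_univ, ← h, ← mem_coe, hS]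
  rfl

/-! ### Sharp constants from certificates -/

/-- Cone parameters of points with positive Cayley-Menger determinant: for every friendly `β`, in every
chamber outside `X_β` at least one of them makes the derivative along `β` negative. -/
def violations : List (Fin 6 → ℕ) :=
  [![1, 0, 20, 1, 1, 1], ![1, 20, 0, 5, 0, 5], ![0, 0, 0, 5, 1, 1], ![0, 5, 0, 0, 1, 1],
    ![2, 1, 1, 70, 100, 1], ![0, 1, 0, 1, 0, 1], ![1, 0, 0, 0, 5, 1]]

section Transfer

variable {β : Finset K4Edge} {S : Finset Decoration} (p : Equiv.Perm (Fin 4))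

theorem relabel_nonneg {good : List (Bool × Finset (Fin 6))} {C : ℝ} {m n : ℕ}
    {c a b : NatPoly 5} (hC : C = m - n) (hgood : ∀ D ∈ S, relPos β D ∈ good)
    (h : ∀ r ∈ good, certifies r.1 r.2 m n c a b = true) :
    ∀ d ∈ chamberUnion (S.image (relabel p)),
      0 ≤ cayleyMengerDeriv (β.image (relabelEdge p)) d * (∑ e, d e) - C * cayleyMenger d := by
  rw [hC]
  refine nonneg_of_certifies (good := good) (fun D hD => ?_) h
  obtain ⟨D, hDS, rfl⟩ := mem_image.1 hD
  rw [relPos_relabel]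
  exact hgood D hDS

theorem relabel_violation
    (hout : ∀ D, D ∉ S → ∃ t ∈ violations, IsViolation (relPos β D).1 (relPos β D).2 t) :
    ∀ D : Decoration, D ∉ S.image (relabel p) →
      ∃ d ∈ D.chamber, 0 < cayleyMenger d ∧ cayleyMengerDeriv (β.image (relabelEdge p)) d < 0 := by
  intro D hD
  obtain ⟨D, rfl⟩ := relabel_surjective p D
  rw [(relabel_injective p).mem_finset_image] at hD
  obtain ⟨t, -, ht⟩ := hout D hD
  rw [← relPos_relabel p] at ht
  exact ht.exists

theorem relabel_exists_neg {C : ℝ}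
    (h : ∃ D ∈ S, ∃ t : Fin 6 → ℝ, (∀ k, 0 ≤ t k) ∧
      defect (relPos β D).1 (relPos β D).2 C t < 0) :
    ∃ d ∈ chamberUnion (S.image (relabel p)),
      cayleyMengerDeriv (β.image (relabelEdge p)) d * (∑ e, d e) - C * cayleyMenger d < 0 := by
  obtain ⟨D, hD, t, ht, hneg⟩ := h
  obtain ⟨d, hd, hx⟩ := exists_mem_chamber (relabel p D) t ht
  refine ⟨d, Set.mem_iUnion₂.2 ⟨_, mem_image_of_mem _ hD, hd⟩, ?_⟩
  rwa [sub_eq_defect hx, relPos_relabel]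

end Transfer

/-- A point with `f < 0` and `g ∑ d = A f` shows that the lower constant `A` is optimal. -/
theorem exists_defect_neg_of_lt {β : Finset K4Edge} {S : Finset Decoration} {t : Fin 6 → ℕ}
    {m n : ℕ} (h : ∃ D ∈ S, cmPos (coneMap (relPos β D).1 t) < cmNeg (coneMap (relPos β D).1 t) ∧
      HasRatio (relPos β D).1 (relPos β D).2 t m n) {A : ℝ} (hA : A = m - n) :
    ∀ C < A, ∃ D ∈ S, ∃ t : Fin 6 → ℝ, (∀ k, 0 ≤ t k) ∧
      defect (relPos β D).1 (relPos β D).2 C t < 0 := by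
  obtain ⟨D, hD, hsign, hratio⟩ := h
  refine fun C hC => ⟨D, hD, fun k => t k, fun k => Nat.cast_nonneg _, ?_⟩
  have hsign := (Nat.cast_lt (α := ℝ)).2 hsign
  rw [cast_cmPos, cast_cmNeg] at hsign
  rw [hratio.defect_eq, cmVal]
  exact mul_neg_of_pos_of_neg (by linarith) (by linarith)

/-- A point with `f > 0` and `g ∑ d = B f` shows that the upper constant `B` is optimal. -/
theorem exists_defect_neg_of_gt {β : Finset K4Edge} {S : Finset Decoration} {t : Fin 6 → ℕ}
    {m n : ℕ} (h : ∃ D ∈ S, cmNeg (coneMap (relPos β D).1 t) < cmPos (coneMap (relPos β D).1 t) ∧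
      HasRatio (relPos β D).1 (relPos β D).2 t m n) {B : ℝ} (hB : B = m - n) :
    ∀ C > B, ∃ D ∈ S, ∃ t : Fin 6 → ℝ, (∀ k, 0 ≤ t k) ∧
      defect (relPos β D).1 (relPos β D).2 C t < 0 := by
  obtain ⟨D, hD, hsign, hratio⟩ := h
  refine fun C hC => ⟨D, hD, fun k => t k, fun k => Nat.cast_nonneg _, ?_⟩
  have hsign := (Nat.cast_lt (α := ℝ)).2 hsign
  rw [cast_cmPos, cast_cmNeg] at hsign
  rw [hratio.defect_eq, cmVal]
  exact mul_neg_of_neg_of_pos (by linarith [show C > B from hC]) (by linarith)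

theorem exists_cayleyMenger_neg {S : Finset Decoration} (hS : S.Nonempty) :
    ∃ d ∈ chamberUnion S, cayleyMenger d < 0 := by
  obtain ⟨D, hD⟩ := hS
  obtain ⟨d, hd, hx⟩ := exists_mem_chamber D (fun k => (![1, 0, 0, 0, 0, 0] : Fin 6 → ℕ) k)
    fun k => Nat.cast_nonneg _
  refine ⟨d, Set.mem_iUnion₂.2 ⟨D, hD, hd⟩, ?_⟩
  have h : ∀ far, cmPos (coneMap far (![1, 0, 0, 0, 0, 0] : Fin 6 → ℕ))
      < cmNeg (coneMap far ![1, 0, 0, 0, 0, 0]) := by decide +kernel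
  have h' := (Nat.cast_lt (α := ℝ)).2 (h D.far)
  rw [cast_cmPos, cast_cmNeg] at h'
  rw [cayleyMenger_eq D.path, hx, cmVal]
  linarith

theorem exists_cayleyMenger_pos {S : Finset Decoration} (hS : S.Nonempty) :
    ∃ d ∈ chamberUnion S, 0 < cayleyMenger d := by
  obtain ⟨D, hD⟩ := hS
  obtain ⟨d, hd, hx⟩ := exists_mem_chamber D (fun k => (![0, 0, 0, 0, 0, 1] : Fin 6 → ℕ) k)
    fun k => Nat.cast_nonneg _
  refine ⟨d, Set.mem_iUnion₂.2 ⟨D, hD, hd⟩, ?_⟩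
  have h : ∀ far, cmNeg (coneMap far (![0, 0, 0, 0, 0, 1] : Fin 6 → ℕ))
      < cmPos (coneMap far ![0, 0, 0, 0, 0, 1]) := by decide +kernel
  have h' := (Nat.cast_lt (α := ℝ)).2 (h D.far)
  rw [cast_cmPos, cast_cmNeg] at h'
  rw [cayleyMenger_eq D.path, hx, cmVal]
  linarith

section Assembly

variable {β : Finset K4Edge} {S : Finset Decoration} {A B : ℝ}
  {good : List (Bool × Finset (Fin 6))} {m n m' n' : ℕ} {c a b : NatPoly 5}

/-- Sharp constants from certificates for one edge set, for all relabellings of it. The chambers in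
`S` are in one of the relative positions in `good`, and only the upper constant needs a square in
its certificate. -/
theorem hasSharpConstants_relabel (p : Equiv.Perm (Fin 4)) (hAB : A < B) (hB : 0 < B)
    (hA_eq : A = m - n) (hB_eq : B = m' - n') (hgood : ∀ D ∈ S, relPos β D ∈ good)
    (hcert : ∀ r ∈ good,
      certifies r.1 r.2 m n 0 0 0 = true ∧ certifies r.1 r.2 m' n' c a b = true)
    (hlt : ∀ C < A, ∃ D ∈ S, ∃ t : Fin 6 → ℝ, (∀ k, 0 ≤ t k) ∧
      defect (relPos β D).1 (relPos β D).2 C t < 0)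
    (hgt : ∀ C > B, ∃ D ∈ S, ∃ t : Fin 6 → ℝ, (∀ k, 0 ≤ t k) ∧
      defect (relPos β D).1 (relPos β D).2 C t < 0)
    (hout : ∀ D, D ∉ S → ∃ t ∈ violations, IsViolation (relPos β D).1 (relPos β D).2 t) :
    HasSharpConstants (β.image (relabelEdge p)) (S.image (relabel p)) A B :=
  hasSharpConstants_of hAB hB
    (relabel_nonneg p hA_eq hgood fun r hr => (hcert r hr).1)
    (relabel_nonneg p hB_eq hgood fun r hr => (hcert r hr).2)
    (fun C hC => relabel_exists_neg p (hlt C hC)) (fun C hC => relabel_exists_neg p (hgt C hC))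
    (relabel_violation p hout)

/-- Version of `hasSharpConstants_relabel` for constants that need not be optimal. -/
theorem exists_hasSharpConstants_relabel (p : Equiv.Perm (Fin 4)) (hAB : A < B) (hB : 0 < B)
    (hA_eq : A = m - n) (hB_eq : B = m' - n') (hgood : ∀ D ∈ S, relPos β D ∈ good)
    (hcert : ∀ r ∈ good,
      certifies r.1 r.2 m n 0 0 0 = true ∧ certifies r.1 r.2 m' n' c a b = true)
    (hne : S.Nonempty)
    (hout : ∀ D, D ∉ S → ∃ t ∈ violations, IsViolation (relPos β D).1 (relPos β D).2 t) :
    ∃ A' B' : ℝ, A' ≤ A ∧ B ≤ B' ∧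
      HasSharpConstants (β.image (relabelEdge p)) (S.image (relabel p)) A' B' :=
  exists_hasSharpConstants hAB hB
    (relabel_nonneg p hA_eq hgood fun r hr => (hcert r hr).1)
    (relabel_nonneg p hB_eq hgood fun r hr => (hcert r hr).2)
    (exists_cayleyMenger_neg (hne.image _)) (exists_cayleyMenger_pos (hne.image _))
    (relabel_violation p hout)

end Assembly

/-! ### The seven types of friendly edge sets -/

section Types

open NatPoly

/-- With the constant `36` the inequality is an equality at the regular tetrahedron, and the quadratic
form that governs it nearby has negative mixed coefficients in the cone parameters. The square in
the certificate absorbs them; likewise in `cycle_sharp`. -/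
theorem full_sharp : HasSharpConstants univ univ 16 36 := by
  have h := hasSharpConstants_relabel (β := univ) (S := univ) (A := 16) (B := 36) (m := 16) (n := 0)
    (m' := 36) (n' := 0) (good := [(false, univ), (true, univ)])
    (c := const 5 6 * (const 5 3 + const 5 16 * X 5 0 + const 5 8 * X 5 1 + const 5 12 * X 5 2
        + const 5 48 * X 5 0 * X 5 2 + const 5 24 * X 5 1 * X 5 2))
    (a := X 5 4) (b := X 5 2 + X 5 2 + X 5 3) 1
    (by norm_num) (by norm_num) (by norm_num) (by norm_num) (by decide +kernel) (by decide +kernel)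
    (exists_defect_neg_of_lt (t := ![1, 0, 0, 0, 0, 0]) (m := 16) (n := 0) (by decide +kernel)
      (by norm_num))
    (exists_defect_neg_of_gt (t := ![0, 0, 0, 0, 0, 1]) (m := 36) (n := 0) (by decide +kernel)
      (by norm_num))
    (by decide +kernel)
  rwa [image_univ_of_surjective (relabel_surjective 1),
    image_univ_of_surjective (Finite.surjective_of_injective (relabelEdge_injective 1))] at h

variable (p : Equiv.Perm (Fin 4))

/-- The chambers for the derivative along the edge `01`. -/
def edgeChambers : Finset Decoration :=
  univ.filter fun D => ¬ {edge 1 0 1} ⊆ D.edges ∧ D.black ∈ (edge 1 0 1).1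

/-- The constant `0` is optimal for a single edge, but it is only approached, along the points with
edge lengths `s + 2, 1, s + 1, s + 1, 1, s + 2`, where `f < 0`. -/
theorem edge_exists_defect_neg_of_lt (C : ℝ) (hC : C < 0) :
    ∃ D ∈ edgeChambers, ∃ t : Fin 6 → ℝ, (∀ k, 0 ≤ t k) ∧
      defect (relPos {edge 1 0 1} D).1 (relPos {edge 1 0 1} D).2 C t < 0 := by
  have hD : ∃ D ∈ edgeChambers, relPos {edge 1 0 1} D = (false, {1}) := by decide +kernel
  obtain ⟨D, hD, hr⟩ := hD
  have hs : 0 < -4 / C := div_pos_of_neg_of_neg (by norm_num) hC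
  have hs' : C * (-4 / C) = -4 := mul_div_cancel₀ _ hC.ne
  refine ⟨D, hD, ![1, -4 / C, 0, 0, 0, 0], fun k => by fin_cases k <;> simp [hs.le], ?_⟩
  rw [hr]
  generalize -4 / C = s at *
  -- At this point the quotient of `g ∑ d` and `f` is `-4 / (s + 1)`.
  have h : defect false {1} C ![1, s, 0, 0, 0, 0]
      = 32 * (s + 1) * (s + 2) ^ 2 * (4 + C * (s + 1)) := by
    simp [defect, cmDer, atEdge, partialPos, partialNeg, perimeter, cmVal, cmPos, cmNeg, coneMap]
    ring
  rw [h]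
  exact mul_neg_of_pos_of_neg (by positivity) (by linarith)

/-- The constant `2` is optimal for a single edge, but it is only approached, along the points with
edge lengths `s + 1, 1, s + 1, s + 1, 1, s + 1`, where `f > 0`. -/
theorem edge_exists_defect_neg_of_gt (C : ℝ) (hC : C > 2) :
    ∃ D ∈ edgeChambers, ∃ t : Fin 6 → ℝ, (∀ k, 0 ≤ t k) ∧
      defect (relPos {edge 1 0 1} D).1 (relPos {edge 1 0 1} D).2 C t < 0 := by
  have hD : ∃ D ∈ edgeChambers, relPos {edge 1 0 1} D = (true, {2}) := by decide +kernel
  obtain ⟨D, hD, hr⟩ := hD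
  have hs : 0 < 2 / (C - 2) := div_pos two_pos (by linarith)
  have hs' : (C - 2) * (2 / (C - 2)) = 2 := mul_div_cancel₀ _ (by linarith)
  refine ⟨D, hD, ![0, 2 / (C - 2), 0, 0, 0, 1], fun k => by fin_cases k <;> simp [hs.le], ?_⟩
  rw [hr]
  generalize 2 / (C - 2) = s at *
  have h : defect true {2} C ![0, s, 0, 0, 0, 1]
      = -8 * ((C - 2) * (1 + s) ^ 2) + 8 * (1 + s) + 4 * C := by
    simp [defect, cmDer, atEdge, partialPos, partialNeg, perimeter, cmVal, cmPos, cmNeg, coneMap]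
    ring
  have h2 : (C - 2) * (1 + s) ^ 2 = (C - 2) + 4 + 2 * s := by linear_combination (2 + s) * hs'
  rw [h, h2]
  linarith

theorem edge_sharp : HasSharpConstants (image (relabelEdge p) {edge 1 0 1})
    (edgeChambers.image (relabel p)) 0 2 :=
  hasSharpConstants_relabel (m := 0) (n := 0) (m' := 2) (n' := 0) (c := 0) (a := 0) (b := 0)
    (good := [(false, {1}), (true, {2}), (true, {4})]) p
    (by norm_num) (by norm_num) (by norm_num) (by norm_num) (by decide +kernel) (by decide +kernel)
    edge_exists_defect_neg_of_lt edge_exists_defect_neg_of_gt (by decide +kernel)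

/-- The chambers for the derivative along the incident edges `01` and `02`. -/
def wedgeChambers : Finset Decoration :=
  univ.filter fun D => Disjoint {edge 1 0 1, edge 1 0 2} D.outerEdges ∧
    ∀ e ∈ ({edge 1 0 1, edge 1 0 2} : Finset K4Edge), D.black ∈ e.1

theorem wedge_sharp : HasSharpConstants (image (relabelEdge p) {edge 1 0 1, edge 1 0 2})
    (wedgeChambers.image (relabel p)) (-8) 12 :=
  hasSharpConstants_relabel (m := 0) (n := 8) (m' := 12) (n' := 0) (c := 0) (a := 0) (b := 0)
    (good := [(false, {1, 3}), (true, {2, 4})]) p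
    (by norm_num) (by norm_num) (by norm_num) (by norm_num) (by decide +kernel) (by decide +kernel)
    (exists_defect_neg_of_lt (t := ![1, 0, 0, 0, 0, 0]) (m := 0) (n := 8) (by decide +kernel)
      (by norm_num))
    (exists_defect_neg_of_gt (t := ![0, 0, 0, 0, 0, 1]) (m := 12) (n := 0) (by decide +kernel)
      (by norm_num))
    (by decide +kernel)

/-- The chambers for the derivative along the opposite edges `01` and `23`. -/
def oppositeChambers : Finset Decoration :=
  univ.filter fun D => ¬ {edge 1 0 1, edge 1 2 3} ⊆ D.edges

theorem opposite_sharp : ∃ A B : ℝ, A ≤ 0 ∧ 4 ≤ B ∧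
    HasSharpConstants (image (relabelEdge p) {edge 1 0 1, edge 1 2 3})
      (oppositeChambers.image (relabel p)) A B :=
  exists_hasSharpConstants_relabel (m := 0) (n := 0) (m' := 4) (n' := 0) (c := 0) (a := 0) (b := 0)
    (good := [(false, {1, 4}), (true, {1, 4}), (false, {2, 3}), (true, {2, 3})]) p
    (by norm_num) (by norm_num) (by norm_num) (by norm_num) (by decide +kernel) (by decide +kernel)
    (by decide +kernel) (by decide +kernel)

/-- The chambers for the derivative along the three edges at the vertex `0`. -/
def tripodChambers : Finset Decoration := univ.filter fun D => D.black = 0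

theorem tripod_sharp :
    HasSharpConstants (image (relabelEdge p) {edge 1 0 1, edge 1 0 2, edge 1 0 3})
      (tripodChambers.image (relabel p)) 8 18 :=
  hasSharpConstants_relabel (m := 8) (n := 0) (m' := 18) (n' := 0) (c := 0) (a := 0) (b := 0)
    (good := [(false, {1, 3, 5}), (true, {2, 4, 5})]) p
    (by norm_num) (by norm_num) (by norm_num) (by norm_num) (by decide +kernel) (by decide +kernel)
    (exists_defect_neg_of_lt (t := ![1, 0, 0, 0, 0, 0]) (m := 8) (n := 0) (by decide +kernel)
      (by norm_num))
    (exists_defect_neg_of_gt (t := ![0, 0, 0, 0, 0, 1]) (m := 18) (n := 0) (by decide +kernel)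
      (by norm_num))
    (by decide +kernel)

/-- The chambers for the derivative along the path `0123`. -/
def pathChambers : Finset Decoration :=
  univ.filter fun D => (D.black = 1 ∨ D.black = 2) ∧
    Disjoint {edge 1 0 1, edge 1 1 2, edge 1 2 3} D.outerEdges

theorem path_sharp : ∃ A B : ℝ, A ≤ -6 ∧ 16 ≤ B ∧
    HasSharpConstants (image (relabelEdge p) {edge 1 0 1, edge 1 1 2, edge 1 2 3})
      (pathChambers.image (relabel p)) A B :=
  exists_hasSharpConstants_relabel (m := 0) (n := 6) (m' := 16) (n' := 0) (c := const 5 1)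
    (a := const 5 1 + const 5 4 * X 5 1) (b := const 5 3 * X 5 3)
    (good := [(false, {1, 2, 3}), (false, {1, 3, 4}), (true, {1, 2, 4}), (true, {2, 3, 4})]) p
    (by norm_num) (by norm_num) (by norm_num) (by norm_num) (by decide +kernel) (by decide +kernel)
    (by decide +kernel) (by decide +kernel)

/-- The chambers for the derivative along the cycle `0123`. -/
def cycleChambers : Finset Decoration :=
  univ.filter fun D => Disjoint {edge 1 0 1, edge 1 1 2, edge 1 2 3, edge 1 3 0} D.outerEdges

theorem cycle_sharp :
    HasSharpConstants (image (relabelEdge p) {edge 1 0 1, edge 1 1 2, edge 1 2 3, edge 1 3 0})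
      (cycleChambers.image (relabel p)) 0 24 :=
  hasSharpConstants_relabel (m := 0) (n := 0) (m' := 24) (n' := 0)
    (c := const 5 12 + const 5 48 * X 5 2) (a := X 5 4) (b := X 5 2 + X 5 2 + X 5 3)
    (good := [(false, {1, 2, 3, 4}), (true, {1, 2, 3, 4})]) p
    (by norm_num) (by norm_num) (by norm_num) (by norm_num) (by decide +kernel) (by decide +kernel)
    (exists_defect_neg_of_lt (t := ![0, 0, 1, 0, 1, 0]) (m := 0) (n := 0) (by decide +kernel)
      (by norm_num))
    (exists_defect_neg_of_gt (t := ![0, 0, 0, 0, 0, 1]) (m := 24) (n := 0) (by decide +kernel)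
      (by norm_num))
    (by decide +kernel)

end Types

/-! ### Classification of the friendly sets, and the theorem -/

instance (β : Finset K4Edge) : Decidable (Friendly β) := inferInstanceAs (Decidable (_ ∧ _))

theorem Friendly.cases : ∀ β : Finset K4Edge, Friendly β → β = univ ∨
    ∃ p : Equiv.Perm (Fin 4), β ∈ ([{edge p 0 1}, {edge p 0 1, edge p 0 2},
      {edge p 0 1, edge p 2 3}, {edge p 0 1, edge p 0 2, edge p 0 3},
      {edge p 0 1, edge p 1 2, edge p 2 3},
      {edge p 0 1, edge p 1 2, edge p 2 3, edge p 3 0}] : List (Finset K4Edge)) := by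
  decide +kernel

section Main

variable (p : Equiv.Perm (Fin 4)) (S : Finset Decoration)

theorem edge_eq_relabelEdge (i j : Fin 4) (h : i ≠ j) :
    edge p i j h = relabelEdge p (edge 1 i j h) := rfl

theorem edge_case
    (hS : (S : Set Decoration)
      = {D : Decoration | ¬ {edge p 0 1} ⊆ D.edges ∧ D.black ∈ (edge p 0 1).1}) :
    #S = 12 ∧ HasSharpConstants {edge p 0 1} S 0 2 := by
  have h : S = edgeChambers.image (relabel p) := eq_image_relabel p hS fun D => by
    rw [edges_relabel, black_relabel, edge_eq_relabelEdge, ← image_singleton,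
      image_subset_image_iff (relabelEdge_injective p), apply_mem_relabelEdge]
  refine ⟨?_, ?_⟩
  · rw [h, card_image_of_injective _ (relabel_injective p)]
    decide +kernel
  · have := edge_sharp p
    rwa [← h, image_singleton] at this

theorem wedge_case
    (hS : (S : Set Decoration) = {D : Decoration | Disjoint {edge p 0 1, edge p 0 2} D.outerEdges ∧
      ∀ e ∈ ({edge p 0 1, edge p 0 2} : Finset K4Edge), D.black ∈ e.1}) :
    #S = 4 ∧ HasSharpConstants {edge p 0 1, edge p 0 2} S (-8) 12 := by
  have h : S = wedgeChambers.image (relabel p) := eq_image_relabel p hS fun D => by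
    simp only [edge_eq_relabelEdge p, outerEdges_relabel, black_relabel, ← image_singleton,
      ← image_insert, disjoint_image (relabelEdge_injective p), forall_mem_image,
      apply_mem_relabelEdge]
  refine ⟨?_, ?_⟩
  · rw [h, card_image_of_injective _ (relabel_injective p)]
    decide +kernel
  · have := wedge_sharp p
    rwa [← h, image_insert, image_singleton] at this

theorem opposite_case
    (hS : (S : Set Decoration) = {D : Decoration | ¬ {edge p 0 1, edge p 2 3} ⊆ D.edges}) :
    #S = 32 ∧ ∃ A B : ℝ, A ≤ 0 ∧ 4 ≤ B ∧
      HasSharpConstants {edge p 0 1, edge p 2 3} S A B := by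
  have h : S = oppositeChambers.image (relabel p) := eq_image_relabel p hS fun D => by
    simp only [edge_eq_relabelEdge p, edges_relabel, ← image_singleton, ← image_insert,
      image_subset_image_iff (relabelEdge_injective p)]
  refine ⟨?_, ?_⟩
  · rw [h, card_image_of_injective _ (relabel_injective p)]
    decide +kernel
  · have := opposite_sharp p
    rwa [← h, image_insert, image_singleton] at this

theorem tripod_case (hS : (S : Set Decoration) = {D : Decoration | D.black = p 0}) :
    #S = 12 ∧ HasSharpConstants {edge p 0 1, edge p 0 2, edge p 0 3} S 8 18 := by
  have h : S = tripodChambers.image (relabel p) := eq_image_relabel p hS fun D => by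
    rw [black_relabel, p.injective.eq_iff]
  refine ⟨?_, ?_⟩
  · rw [h, card_image_of_injective _ (relabel_injective p)]
    decide +kernel
  · have := tripod_sharp p
    rwa [← h, image_insert, image_insert, image_singleton] at this

theorem path_case
    (hS : (S : Set Decoration) = {D : Decoration | (D.black = p 1 ∨ D.black = p 2) ∧
      Disjoint {edge p 0 1, edge p 1 2, edge p 2 3} D.outerEdges}) :
    #S = 8 ∧ ∃ A B : ℝ, A ≤ -6 ∧ 16 ≤ B ∧
      HasSharpConstants {edge p 0 1, edge p 1 2, edge p 2 3} S A B := by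
  have h : S = pathChambers.image (relabel p) := eq_image_relabel p hS fun D => by
    simp only [edge_eq_relabelEdge p, outerEdges_relabel, black_relabel, ← image_singleton,
      ← image_insert, disjoint_image (relabelEdge_injective p), p.injective.eq_iff]
  refine ⟨?_, ?_⟩
  · rw [h, card_image_of_injective _ (relabel_injective p)]
    decide +kernel
  · have := path_sharp p
    rwa [← h, image_insert, image_insert, image_singleton] at this

theorem cycle_case
    (hS : (S : Set Decoration) = {D : Decoration |
      Disjoint {edge p 0 1, edge p 1 2, edge p 2 3, edge p 3 0} D.outerEdges}) :
    #S = 16 ∧ HasSharpConstants {edge p 0 1, edge p 1 2, edge p 2 3, edge p 3 0} S 0 24 := by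
  have h : S = cycleChambers.image (relabel p) := eq_image_relabel p hS fun D => by
    simp only [edge_eq_relabelEdge p, outerEdges_relabel, ← image_singleton,
      ← image_insert, disjoint_image (relabelEdge_injective p)]
  refine ⟨?_, ?_⟩
  · rw [h, card_image_of_injective _ (relabel_injective p)]
    decide +kernel
  · have := cycle_sharp p
    rwa [← h, image_insert, image_insert, image_insert, image_singleton] at this

end Main

theorem theorem1p4 :
    -- every friendly edge subset
    (∀ β : Finset K4Edge, Friendly β →
      ∃ S : Finset Decoration, S.Nonempty ∧ ∃ A B : ℝ, HasSharpConstants β S A B) ∧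
    -- all of `K₄`
    (chamberUnion univ = pseudoTetrahedra ∧ HasSharpConstants univ univ 16 36) ∧
    -- a single edge
    (∀ (p : Equiv.Perm (Fin 4)) (β : Finset K4Edge) (S : Finset Decoration),
      β = {edge p 0 1} →
      (S : Set Decoration) = {D : Decoration | ¬ β ⊆ D.edges ∧ D.black ∈ (edge p 0 1).1} →
      #S = 12 ∧ HasSharpConstants β S 0 2) ∧
    -- a pair of incident edges
    (∀ (p : Equiv.Perm (Fin 4)) (β : Finset K4Edge) (S : Finset Decoration),
      β = {edge p 0 1, edge p 0 2} →
      (S : Set Decoration) = {D : Decoration | Disjoint β D.outerEdges ∧ ∀ e ∈ β, D.black ∈ e.1} →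
      #S = 4 ∧ HasSharpConstants β S (-8) 12) ∧
    -- a pair of opposite edges
    (∀ (p : Equiv.Perm (Fin 4)) (β : Finset K4Edge) (S : Finset Decoration),
      β = {edge p 0 1, edge p 2 3} →
      (S : Set Decoration) = {D : Decoration | ¬ β ⊆ D.edges} →
      #S = 32 ∧ ∃ A B : ℝ, A ≤ 0 ∧ 4 ≤ B ∧ HasSharpConstants β S A B) ∧
    -- a tripod with apex `p 0`
    (∀ (p : Equiv.Perm (Fin 4)) (β : Finset K4Edge) (S : Finset Decoration),
      β = {edge p 0 1, edge p 0 2, edge p 0 3} →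
      (S : Set Decoration) = {D : Decoration | D.black = p 0} →
      #S = 12 ∧ HasSharpConstants β S 8 18) ∧
    -- a 3-path with interior vertices `p 1` and `p 2`
    (∀ (p : Equiv.Perm (Fin 4)) (β : Finset K4Edge) (S : Finset Decoration),
      β = {edge p 0 1, edge p 1 2, edge p 2 3} →
      (S : Set Decoration) = {D : Decoration | (D.black = p 1 ∨ D.black = p 2) ∧ Disjoint β D.outerEdges} →
      #S = 8 ∧ ∃ A B : ℝ, A ≤ -6 ∧ 16 ≤ B ∧ HasSharpConstants β S A B) ∧
    -- a 4-cycle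
    (∀ (p : Equiv.Perm (Fin 4)) (β : Finset K4Edge) (S : Finset Decoration),
      β = {edge p 0 1, edge p 1 2, edge p 2 3, edge p 3 0} →
      (S : Set Decoration) = {D : Decoration | Disjoint β D.outerEdges} →
      #S = 16 ∧ HasSharpConstants β S 0 24) := by

  refine ⟨fun β hβ => ?_, ⟨chamberUnion_univ, full_sharp⟩, ?_, ?_, ?_, ?_, ?_, ?_⟩
  · have exists_finset (P : Decoration → Prop) :
        ∃ S : Finset Decoration, (S : Set Decoration) = {D | P D} :=
      ⟨(Set.toFinite {D | P D}).toFinset, Set.Finite.coe_toFinset _⟩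
    have nonempty_of_card {S : Finset Decoration} {n : ℕ} (h : #S = n) (hn : 0 < n) :
        S.Nonempty := card_pos.1 (h ▸ hn)
    rcases hβ.cases with rfl | ⟨p, hp⟩
    · exact ⟨univ, univ_nonempty_iff.2 ⟨⟨(1, 2), Or.inl rfl⟩⟩, 16, 36, full_sharp⟩
    simp only [List.mem_cons, List.not_mem_nil, or_false] at hp
    rcases hp with rfl | rfl | rfl | rfl | rfl | rfl
    · obtain ⟨S, hS⟩ := exists_finset _
      obtain ⟨hc, h⟩ := edge_case p S hS
      exact ⟨S, nonempty_of_card hc (by norm_num), _, _, h⟩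
    · obtain ⟨S, hS⟩ := exists_finset _
      obtain ⟨hc, h⟩ := wedge_case p S hS
      exact ⟨S, nonempty_of_card hc (by norm_num), _, _, h⟩
    · obtain ⟨S, hS⟩ := exists_finset _
      obtain ⟨hc, A, B, -, -, h⟩ := opposite_case p S hS
      exact ⟨S, nonempty_of_card hc (by norm_num), A, B, h⟩
    · obtain ⟨S, hS⟩ := exists_finset _
      obtain ⟨hc, h⟩ := tripod_case p S hS
      exact ⟨S, nonempty_of_card hc (by norm_num), _, _, h⟩
    · obtain ⟨S, hS⟩ := exists_finset _
      obtain ⟨hc, A, B, -, -, h⟩ := path_case p S hS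
      exact ⟨S, nonempty_of_card hc (by norm_num), A, B, h⟩
    · obtain ⟨S, hS⟩ := exists_finset _
      obtain ⟨hc, h⟩ := cycle_case p S hS
      exact ⟨S, nonempty_of_card hc (by norm_num), _, _, h⟩
  · rintro p _ S rfl hS
    exact edge_case p S hS
  · rintro p _ S rfl hS
    exact wedge_case p S hS
  · rintro p _ S rfl hS
    exact opposite_case p S hS
  · rintro p _ S rfl hS
    exact tripod_case p S hS
  · rintro p _ S rfl hS
    exact path_case p S hS
  · rintro p _ S rfl hS
    exact cycle_case p S hS
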